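/- Let $k$ be an algebraically closed field of characteristic $0$. Let $(q_{ij})_{0\le i,j\le 3}$ and $(q'_{ij})_{0\le i,j\le 2}$ be elements of $k^\times$ with $q_{ii}=q_{ij}q_{ji}=q_{ij}^4=1$ and $q'_{ii}=q'_{ij}q'_{ji}=(q'_{ij})^3=1$, and put $$A=k\langle x_0,\dots,x_3\rangle/(x_jx_i-q_{ji}x_ix_j)_{i,j},\qquad B=k\langle y_0,y_1,y_2\rangle/(y_jy_i-q'_{ji}y_iy_j)_{i,j},$$ $f=\sum_{i=0}^3x_i^4\in A$, $g=\sum_{i=0}^2y_i^3\in B$. Let $J=(f,g)$ be the two-sided ideal of the $\mathbb N^2$-graded algebra $A\otimes_kB$ generated by $f\otimes1$ and $1\otimes g$, let $A\circ B=\bigoplus_{i\ge0}A_i\otimes_kB_i$ be the Segre product, with its $\mathbb N$-grading, and let $J_\Delta=\bigoplus_{i\ge0}J_{(i,i)}$. Assume the Calabi–Yau condition: neither $\prod_{i=0}^3q_{ij}$ nor $\prod_{i=0}^2q'_{ij}$ depends on $j$. Assume that $\{q_{ij}\}$ is general, i.e. $q_{ij}q_{jl}q_{li}\ne1$ for some $i,j,l$.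 A point module of a connected graded $k$-algebra $C=\bigoplus_dC_d$ (graded by $\mathbb N$ or $\mathbb N^2$) is a graded right $C$-module $M=\bigoplus_d M_d$ that is cyclic, generated in degree $0$, with $\dim_kM_d=1$ for all $d$. The moduli space $\mathcal M_C$ is the set of isomorphism classes of point modules with the Zariski topology, i.e. the topology induced by the embedding into $\prod_d\mathbb P(C_d^*)$ that sends $M=m_0C$ to the classes of the linear forms $C_d\to M_d\cong k$, $a\mapsto m_0a$. Then $\dim\mathcal M_{A\otimes_kB/J}=1$ and $\dim\mathcal M_{A\circ B/J_\Delta}=1$, where $\dim$ is the Krull dimension of the topological space. -/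

import Mathlib

open scoped TensorProduct

noncomputable section

/-! ### Point modules of a graded algebra and their moduli space

Everything is written for an algebra graded by an additive monoid `ι`; it is used for `ι = ℕ` and
`ι = ℕ × ℕ`. A right module is a module over the opposite ring. -/

section PointModules

universe u v w

variable {k : Type u} [Field k] {C : Type v} [Ring C] [Algebra k C]
  {ι : Type w} [AddMonoid ι] [DecidableEq ι]

/-- A point module of the graded `k`-algebra `C = ⨁ 𝒞 d`: a graded right `C`-module which is
cyclic, generated in degree `0`, and has `dim M_d = 1` for all `d`. -/
structure PointModule (𝒞 : ι → Submodule k C) where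
  carrier : Type v
  [addCommGroup : AddCommGroup carrier]
  [module : Module k carrier]
  [rightModule : Module Cᵐᵒᵖ carrier]
  [isScalarTower : IsScalarTower k Cᵐᵒᵖ carrier]
  /-- the homogeneous components -/
  comp : ι → Submodule k carrier
  isInternal : DirectSum.IsInternal comp
  smul_mem : ∀ ⦃d e : ι⦄ ⦃m : carrier⦄ ⦃a : C⦄, m ∈ comp d → a ∈ 𝒞 e →
    MulOpposite.op a • m ∈ comp (d + e)
  cyclic : ∃ m ∈ comp 0, Submodule.span Cᵐᵒᵖ {m} = ⊤
  finrank_comp : ∀ d, Module.finrank k (comp d) = 1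

attribute [instance] PointModule.addCommGroup PointModule.module PointModule.rightModule
  PointModule.isScalarTower

variable {𝒞 : ι → Submodule k C}

/-- Two point modules are isomorphic if there is a degree-preserving isomorphism of right
`C`-modules between them. -/
def PointModule.Iso (M N : PointModule 𝒞) : Prop :=
  ∃ e : M.carrier ≃ₗ[Cᵐᵒᵖ] N.carrier, ∀ d, ∀ m : M.carrier, m ∈ M.comp d ↔ e m ∈ N.comp d

theorem PointModule.iso_equivalence :
    Equivalence (PointModule.Iso : PointModule 𝒞 → PointModule 𝒞 → Prop) where
  refl M := ⟨LinearEquiv.refl _ _, fun _ _ => Iff.rfl⟩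
  symm := by
    rintro M N ⟨e, he⟩
    exact ⟨e.symm, fun d n => by rw [he d (e.symm n), e.apply_symm_apply]⟩
  trans := by
    rintro M N P ⟨e, he⟩ ⟨e', he'⟩
    exact ⟨e.trans e', fun d m => (he d m).trans (he' d (e m))⟩

variable (𝒞) in
/-- Isomorphism of point modules as a setoid. -/
def PointModule.setoid : Setoid (PointModule 𝒞) where
  r := PointModule.Iso
  iseqv := PointModule.iso_equivalence

variable (𝒞) in
/-- The points of the moduli space of point modules: isomorphism classes of point modules. -/
def PointModuli : Type _ := Quotient (PointModule.setoid 𝒞)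

/-- `φ` is a system of multihomogeneous coordinates of the point module `M`: for some choice of
basis vectors `m d` of the lines `M_d` one has `m 0 · a = φ_d(a) m d` for all `a` in `𝒞 d`. Thus
`φ_d` is the linear form `C_d → M_d ≅ k`, i.e. the point of the projective space of
one-dimensional quotients of `C_d` given by `M`; another choice of the `m d` rescales each `φ_d`
by a nonzero scalar. -/
def PointModule.IsCoord (M : PointModule 𝒞) (φ : (Σ d, 𝒞 d) → k) : Prop :=
  ∃ m : ι → M.carrier, (∀ d, m d ∈ M.comp d ∧ m d ≠ 0) ∧
    ∀ d (a : 𝒞 d), MulOpposite.op (a : C) • m 0 = φ ⟨d, a⟩ • m d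

/-- A polynomial in the coordinates `φ_d(a)` is multihomogeneous if for every `d` it is
homogeneous in the coordinates `φ_d(a)`, `a ∈ 𝒞 d`, of some degree `n d`. -/
def IsMultihomogeneous (p : MvPolynomial (Σ d, 𝒞 d) k) : Prop :=
  ∃ n : ι →₀ ℕ, MvPolynomial.IsWeightedHomogeneous
    (fun s : (Σ d, 𝒞 d) => Finsupp.single s.1 1) p n

variable (𝒞) in
/-- The locus in the moduli space where the multihomogeneous polynomial `p` does not vanish. -/
def PointModuli.basicOpen (p : MvPolynomial (Σ d, 𝒞 d) k) : Set (PointModuli 𝒞) :=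
  {z | ∃ (M : PointModule 𝒞) (φ : (Σ d, 𝒞 d) → k),
    Quotient.mk (PointModule.setoid 𝒞) M = z ∧ M.IsCoord φ ∧ MvPolynomial.eval φ p ≠ 0}

/-- The Zariski topology of the moduli space, i.e. the one induced from the product over all `d` of
the projective spaces of one-dimensional quotients of `C_d`. -/
instance PointModuli.zariskiTopology : TopologicalSpace (PointModuli 𝒞) :=
  TopologicalSpace.generateFrom
    {U | ∃ p : MvPolynomial (Σ d, 𝒞 d) k, IsMultihomogeneous p ∧ U = PointModuli.basicOpen 𝒞 p}

end PointModules

/-! ### Quantum polynomial rings, the algebra `A ⊗ B / J` and the Segre product `A ∘ B / J_Δ` -/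

section Algebras

universe u

variable {k : Type u} [Field k] {n m : ℕ}

/-- The relations `x_j x_i = q_{ji} x_i x_j`. -/
inductive QuantumRel (q : Fin n → Fin n → k) :
    FreeAlgebra k (Fin n) → FreeAlgebra k (Fin n) → Prop
  | comm (i j : Fin n) : QuantumRel q (FreeAlgebra.ι k j * FreeAlgebra.ι k i)
      (q j i • (FreeAlgebra.ι k i * FreeAlgebra.ι k j))

/-- The quantum polynomial ring `k⟨x_0, …, x_{n-1}⟩ / (x_j x_i - q_{ji} x_i x_j)`. -/
def QuantumPoly (q : Fin n → Fin n → k) : Type u := RingQuot (QuantumRel q)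

instance (q : Fin n → Fin n → k) : Ring (QuantumPoly q) :=
  inferInstanceAs (Ring (RingQuot (QuantumRel q)))

instance (q : Fin n → Fin n → k) : Algebra k (QuantumPoly q) :=
  inferInstanceAs (Algebra k (RingQuot (QuantumRel q)))

/-- The generator `x_i`. -/
def QuantumPoly.x (q : Fin n → Fin n → k) (i : Fin n) : QuantumPoly q :=
  RingQuot.mkAlgHom k (QuantumRel q) (FreeAlgebra.ι k i)

/-- The component of degree `d`, spanned by the products of `d` generators. -/
def QuantumPoly.deg (q : Fin n → Fin n → k) (d : ℕ) : Submodule k (QuantumPoly q) :=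
  Submodule.span k (Set.range (QuantumPoly.x q)) ^ d

/-- The Fermat element `∑ x_i ^ n` in the quantum polynomial ring in `n` variables. -/
def QuantumPoly.fermat (q : Fin n → Fin n → k) : QuantumPoly q :=
  ∑ i, QuantumPoly.x q i ^ n

instance (q : Fin n → Fin n → k) : SetLike.GradedMonoid (QuantumPoly.deg q) :=
  Submodule.nat_power_gradedMonoid _

section Tensor

variable {A B : Type u} [Ring A] [Algebra k A] [Ring B] [Algebra k B]
  (𝒜 : ℕ → Submodule k A) (ℬ : ℕ → Submodule k B)

/-- The component `A_i ⊗ B_j` of degree `(i, j)` of the bigraded algebra `A ⊗ B`. -/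
def tensorDeg (d : ℕ × ℕ) : Submodule k (A ⊗[k] B) :=
  LinearMap.range (TensorProduct.map (𝒜 d.1).subtype (ℬ d.2).subtype)

/-- The component of degree `d` of the quotient of `A ⊗ B` by a (bihomogeneous) two-sided ideal:
the image of `(A ⊗ B)_d`. -/
def tensorQuotDeg (J : TwoSidedIdeal (A ⊗[k] B)) (d : ℕ × ℕ) :
    Submodule k J.ringCon.Quotient :=
  (tensorDeg 𝒜 ℬ d).map (J.ringCon.mkₐ k).toLinearMap

variable [SetLike.GradedMonoid 𝒜] [SetLike.GradedMonoid ℬ]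

theorem one_mem_tensorDeg : (1 : A ⊗[k] B) ∈ tensorDeg 𝒜 ℬ (0, 0) :=
  ⟨⟨1, SetLike.GradedOne.one_mem⟩ ⊗ₜ ⟨1, SetLike.GradedOne.one_mem⟩, rfl⟩

theorem mul_mem_tensorDeg {d e : ℕ × ℕ} {a b : A ⊗[k] B}
    (ha : a ∈ tensorDeg 𝒜 ℬ d) (hb : b ∈ tensorDeg 𝒜 ℬ e) :
    a * b ∈ tensorDeg 𝒜 ℬ (d + e) := by
  obtain ⟨s, rfl⟩ := ha
  obtain ⟨t, rfl⟩ := hb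
  induction s with
  | zero => simp
  | add s₁ s₂ h₁ h₂ => rw [map_add, add_mul]; exact add_mem h₁ h₂
  | tmul a₁ a₂ =>
    induction t with
    | zero => simp
    | add t₁ t₂ h₁ h₂ => rw [map_add, mul_add]; exact add_mem h₁ h₂
    | tmul b₁ b₂ =>
      exact ⟨⟨a₁ * b₁, SetLike.GradedMul.mul_mem a₁.2 b₁.2⟩ ⊗ₜ
        ⟨a₂ * b₂, SetLike.GradedMul.mul_mem a₂.2 b₂.2⟩, by simp⟩

/-- The Segre product `A ∘ B = ⨁ A_i ⊗ B_i`, as a subalgebra of `A ⊗ B`. -/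
def segreProduct : Subalgebra k (A ⊗[k] B) :=
  (⨆ i : ℕ, tensorDeg 𝒜 ℬ (i, i)).toSubalgebra
    (Submodule.mem_iSup_of_mem (p := fun i : ℕ => tensorDeg 𝒜 ℬ (i, i)) 0
      (one_mem_tensorDeg 𝒜 ℬ)) (by
      intro a b ha hb
      induction ha using Submodule.iSup_induction' with
      | zero => simp
      | add a₁ a₂ _ _ h₁ h₂ => rw [add_mul]; exact add_mem h₁ h₂
      | mem i a ha =>
        induction hb using Submodule.iSup_induction' with
        | zero => simp
        | add b₁ b₂ _ _ h₁ h₂ => rw [mul_add]; exact add_mem h₁ h₂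
        | mem j b hb =>
          have h := mul_mem_tensorDeg 𝒜 ℬ ha hb
          rw [Prod.mk_add_mk] at h
          exact Submodule.mem_iSup_of_mem (p := fun i : ℕ => tensorDeg 𝒜 ℬ (i, i)) (i + j) h)

/-- The ideal `J_Δ = ⨁ J_{(i,i)}` of `A ∘ B`; for a bihomogeneous ideal `J` of `A ⊗ B` it is
`J ∩ (A ∘ B)`. -/
def diagIdeal (J : TwoSidedIdeal (A ⊗[k] B)) : TwoSidedIdeal (segreProduct 𝒜 ℬ) :=
  J.comap (segreProduct 𝒜 ℬ).val

/-- The component of degree `i` of `A ∘ B / J_Δ`: the image of `A_i ⊗ B_i`. -/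
def segreQuotDeg (J : TwoSidedIdeal (A ⊗[k] B)) (i : ℕ) :
    Submodule k (diagIdeal 𝒜 ℬ J).ringCon.Quotient :=
  ((tensorDeg 𝒜 ℬ (i, i)).comap (segreProduct 𝒜 ℬ).val.toLinearMap).map
    ((diagIdeal 𝒜 ℬ J).ringCon.mkₐ k).toLinearMap

end Tensor

variable (q : Fin n → Fin n → k) (q' : Fin m → Fin m → k)

/-- The two-sided ideal `J = (f, g)` of `A ⊗ B`, for quantum polynomial rings `A` and `B` and their
Fermat elements `f` and `g`. -/
def idealJ : TwoSidedIdeal (QuantumPoly q ⊗[k] QuantumPoly q') :=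
  TwoSidedIdeal.span {QuantumPoly.fermat q ⊗ₜ[k] 1, 1 ⊗ₜ[k] QuantumPoly.fermat q'}

/-- The moduli space of point modules of the bigraded algebra `A ⊗ B / J`. -/
abbrev TensorPointModuli : Type _ :=
  PointModuli (tensorQuotDeg (QuantumPoly.deg q) (QuantumPoly.deg q') (idealJ q q'))

/-- The moduli space of point modules of the graded algebra `A ∘ B / J_Δ`. -/
abbrev SegrePointModuli : Type _ :=
  PointModuli (segreQuotDeg (QuantumPoly.deg q) (QuantumPoly.deg q') (idealJ q q'))

end Algebras

/-! ### Conditions on the parameters -/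

section Parameters

variable {k : Type*} [Field k] {n : ℕ}

/-- The standing conditions `q_{ii} = q_{ij} q_{ji} = q_{ij}^n = 1` in `n` variables. -/
structure IsQuantumParameter (q : Fin n → Fin n → k) : Prop where
  diag : ∀ i, q i i = 1
  mul_swap : ∀ i j, q i j * q j i = 1
  pow_eq_one : ∀ i j, q i j ^ n = 1

/-- The Calabi–Yau condition: `∏_i q_{ij}` does not depend on `j`. -/
def IsCalabiYauParameter (q : Fin n → Fin n → k) : Prop :=
  ∀ j j' : Fin n, ∏ i, q i j = ∏ i, q i j'

/-- `{q_{ij}}` is special if `q_{ij} q_{jl} q_{li} = 1` for all `i, j, l`. -/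
def IsSpecialParameter (q : Fin n → Fin n → k) : Prop :=
  ∀ i j l : Fin n, q i j * q j l * q l i = 1

/-- `{q_{ij}}` is general if it is not special. -/
def IsGeneralParameter (q : Fin n → Fin n → k) : Prop :=
  ¬ IsSpecialParameter q

end Parameters

end

/-!
Along a basis `m_d` of homogeneous vectors, the generators act on a point module of `A ⊗ B / J` by
`m_(a, b) · x_i = P a i • m_(a + 1, b)` and `m_(a, b) · y_j = R b j • m_(a, b + 1)`, for sequences
`P`, `R` of nonzero vectors which satisfy the commutation relations and kill `f` and `g`. Over the
diagonal, the products `x_i y_j` act by `P d i * R d j`, and the relations between these products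
still separate `P` from `R`. In both cases the commutation relations determine a sequence, up to
scalars, from its initial vector, so a point module amounts to the points `[P 0]` and `[R 0]`.

If `P 0` is nonzero at `i`, `j` and `l`, then `q i j * q j l * q l i = 1`. The Calabi–Yau condition
propagates one such relation with distinct indices to all of them; hence for general parameters in
four variables at most two coordinates of `P 0` are nonzero, and the Fermat relation leaves
finitely many points `[P 0]`. In three variables it makes all the products
`q' i j * q' j l * q' l i` equal to `1`, and `[R 0]` runs through the Fermat cubic. The moduli space
is therefore a finite union of closed copies of the cubic, and on each copy a proper closed subset
is finite, as the affine cubic is the zero locus of an irreducible polynomial.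
-/

noncomputable section

section Topology

open TopologicalSpace Set Topology

variable {X : Type*} [TopologicalSpace X]

/-- Topological form of an irreducible algebraic curve: an infinite closed set all of whose proper
closed subsets are finite. -/
structure IsTopologicalCurve (W : Set X) : Prop where
  isClosed : IsClosed W
  infinite : W.Infinite
  finite_inter_or_subset : ∀ Z, IsClosed Z → (Z ∩ W).Finite ∨ W ⊆ Z

theorem IsTopologicalCurve.isIrreducible {W : Set X} (hW : IsTopologicalCurve W) :
    IsIrreducible W := by
  refine ⟨hW.infinite.nonempty, isPreirreducible_iff_isClosed_union_isClosed.2 ?_⟩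
  intro Z₁ Z₂ h₁ h₂ h
  by_contra! hcon
  have f₁ := (hW.finite_inter_or_subset Z₁ h₁).resolve_right hcon.1
  have f₂ := (hW.finite_inter_or_subset Z₂ h₂).resolve_right hcon.2
  exact hW.infinite ((f₁.union f₂).subset fun x hx => (h hx).imp (⟨·, hx⟩) (⟨·, hx⟩))

theorem IsTopologicalCurve.subset_of_subset {V W : Set X} (hV : IsTopologicalCurve V)
    (hW : IsTopologicalCurve W) (h : V ⊆ W) : W ⊆ V :=
  (hW.finite_inter_or_subset V hV.isClosed).resolve_left fun hf =>
    hV.infinite (inter_eq_left.2 h ▸ hf)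

theorem exists_subset_of_isIrreducible_of_subset_iUnion {F : Type*} [Finite F] {Z : Set X}
    (hZ : IsIrreducible Z) {W : F → Set X} (hW : ∀ s, IsClosed (W s)) (h : Z ⊆ ⋃ s, W s) :
    ∃ s, Z ⊆ W s := by
  obtain ⟨_, hs, hZs⟩ := isIrreducible_iff_sUnion_isClosed.1 hZ (finite_range W).toFinset
    (by simpa using hW) (by simpa using h)
  obtain ⟨s, rfl⟩ := (finite_range W).mem_toFinset.1 hs
  exact ⟨s, hZs⟩

theorem exists_eq_singleton_of_isIrreducible_of_finite [T1Space X] {Z : Set X}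
    (hZ : IsIrreducible Z) (hfin : Z.Finite) : ∃ x, Z = {x} := by
  have := hfin.to_subtype
  obtain ⟨x, hx⟩ := exists_subset_of_isIrreducible_of_subset_iUnion hZ
    (W := fun x : Z => {(x : X)}) (fun _ => isClosed_singleton) fun x hx =>
      mem_iUnion.2 ⟨⟨x, hx⟩, rfl⟩
  exact ⟨x, (hZ.nonempty.subset_singleton_iff).1 hx⟩

section Cover

variable [T1Space X] {F : Type*} [Finite F] {W : F → Set X}

theorem exists_eq_singleton_or_eq_of_isTopologicalCurve_cover
    (hW : ∀ s, IsTopologicalCurve (W s)) (hcover : ⋃ s, W s = univ) (Z : IrreducibleCloseds X) :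
    (∃ x, (Z : Set X) = {x}) ∨ ∃ s, (Z : Set X) = W s := by
  obtain ⟨s, hs⟩ := exists_subset_of_isIrreducible_of_subset_iUnion Z.isIrreducible
    (fun s => (hW s).isClosed) (hcover ▸ subset_univ _)
  rcases (hW s).finite_inter_or_subset Z Z.isClosed with hfin | hsub
  · rw [inter_eq_left.2 hs] at hfin
    exact .inl (exists_eq_singleton_of_isIrreducible_of_finite Z.isIrreducible hfin)
  · exact .inr ⟨s, hs.antisymm hsub⟩

theorem topologicalKrullDim_le_one_of_isTopologicalCurve_cover
    (hW : ∀ s, IsTopologicalCurve (W s)) (hcover : ⋃ s, W s = univ) :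
    topologicalKrullDim X ≤ 1 := by
  refine Order.krullDim_le_one_iff.2 fun Z => ?_
  rcases exists_eq_singleton_or_eq_of_isTopologicalCurve_cover hW hcover Z with
    ⟨x, hx⟩ | ⟨s, hs⟩
  · refine .inl fun Y hYZ => ?_
    have hY : (Y : Set X) ⊆ {x} := hx ▸ hYZ
    have hYx : (Y : Set X) = {x} := (Y.isIrreducible.nonempty.subset_singleton_iff).1 hY
    exact le_of_eq (SetLike.coe_injective (hx.trans hYx.symm))
  · refine .inr fun Y hZY => ?_
    have hY : W s ⊆ (Y : Set X) := hs ▸ hZY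
    rcases exists_eq_singleton_or_eq_of_isTopologicalCurve_cover hW hcover Y with
      ⟨x, hx⟩ | ⟨t, ht⟩
    · exact absurd ((finite_singleton x).subset (hx ▸ hY)) (hW s).infinite
    · have hYZ : (Y : Set X) ⊆ Z := by
        rw [ht, hs]
        exact (hW s).subset_of_subset (hW t) (ht ▸ hY)
      exact hYZ

theorem one_le_topologicalKrullDim_of_isTopologicalCurve {W : Set X}
    (hW : IsTopologicalCurve W) : 1 ≤ topologicalKrullDim X := by
  obtain ⟨x, hx⟩ := hW.infinite.nonempty
  refine Order.one_le_krullDim_iff.2 ⟨⟨{x}, isIrreducible_singleton, isClosed_singleton⟩,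
    ⟨W, hW.isIrreducible, hW.isClosed⟩, lt_of_le_of_ne (singleton_subset_iff.2 hx) fun h => ?_⟩
  have hxW : ({x} : Set X) = W := congrArg IrreducibleCloseds.carrier h
  exact hW.infinite (hxW ▸ finite_singleton x)

theorem topologicalKrullDim_eq_one_of_isTopologicalCurve_cover [Nonempty F]
    (hW : ∀ s, IsTopologicalCurve (W s)) (hcover : ⋃ s, W s = univ) :
    topologicalKrullDim X = 1 :=
  le_antisymm (topologicalKrullDim_le_one_of_isTopologicalCurve_cover hW hcover)
    (one_le_topologicalKrullDim_of_isTopologicalCurve (hW (Classical.arbitrary F)))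

end Cover

theorem finite_inter_or_subset_of_isClosed_generateFrom {Y : Type*} {g : Set (Set Y)} {W : Set Y}
    (h : ∀ U ∈ g, (W \ U).Finite ∨ Disjoint W U) {Z : Set Y}
    (hZ : IsClosed[TopologicalSpace.generateFrom g] Z) : (Z ∩ W).Finite ∨ W ⊆ Z := by
  have key : ∀ U : Set Y, TopologicalSpace.GenerateOpen g U →
      (W \ U).Finite ∨ Disjoint W U := by
    intro U hU
    induction hU with
    | basic s hs => exact h s hs
    | univ => left; simp
    | inter s t _ _ hs ht =>
      rcases hs with hs | hs
      · rcases ht with ht | ht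
        · left; rw [sdiff_inter]; exact hs.union ht
        · right; exact ht.mono_right inter_subset_right
      · right; exact hs.mono_right inter_subset_left
    | sUnion S _ ih =>
      by_cases hS : ∃ s ∈ S, (W \ s).Finite
      · obtain ⟨s, hs, hf⟩ := hS
        exact Or.inl (hf.subset (sdiff_subset_sdiff_right (subset_sUnion_of_mem hs)))
      · push Not at hS
        exact Or.inr (disjoint_sUnion_right.2 fun s hs => (ih s hs).resolve_left (hS s hs))
  have hU := key Zᶜ ((@isOpen_compl_iff Y Z (TopologicalSpace.generateFrom g)).2 hZ)
  rwa [sdiff_compl, inter_comm, disjoint_compl_right_iff_subset] at hU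

end Topology

section FermatCubic

open Polynomial

theorem exists_C_mul_eq_of_not_dvd {R : Type*} [CommRing R] [IsDomain R] {f G : R[X]}
    (hmonic : f.Monic) (hprime : Prime f) (hG : ¬ f ∣ G) :
    ∃ h : R, h ≠ 0 ∧ ∃ u v : R[X], C h = f * u + G * v := by
  have : (Ideal.span {f}).IsPrime := by rwa [Ideal.span_singleton_prime hprime.ne_zero]
  have : IsDomain (AdjoinRoot f) := Ideal.Quotient.isDomain _
  have : Module.Finite R (AdjoinRoot f) := hmonic.finite_adjoinRoot
  have hG0 : AdjoinRoot.mk f G ≠ 0 := by rwa [Ne, AdjoinRoot.mk_eq_zero]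
  obtain ⟨h, hh, hh0⟩ := Submodule.exists_mem_ne_zero_of_ne_bot
    (Ideal.comap_ne_bot_of_integral_mem (R := R) hG0 (Ideal.mem_span_singleton_self _)
      (Algebra.IsIntegral.isIntegral _))
  obtain ⟨v, hv⟩ := Ideal.mem_span_singleton.1 (Ideal.mem_comap.1 hh)
  obtain ⟨v, rfl⟩ := AdjoinRoot.mk_surjective v
  rw [← map_mul, AdjoinRoot.algebraMap_eq, ← AdjoinRoot.mk_C, AdjoinRoot.mk_eq_mk] at hv
  obtain ⟨u, hu⟩ := hv
  exact ⟨h, hh0, u, v, sub_eq_iff_eq_add.1 hu⟩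

variable {k : Type*} [Field k]

theorem finite_common_zeros_of_not_dvd {f G : k[X][X]} (hmonic : f.Monic) (hprime : Prime f)
    (hG : ¬ f ∣ G) :
    {p : k × k | f.evalEval p.1 p.2 = 0 ∧ G.evalEval p.1 p.2 = 0}.Finite := by
  obtain ⟨h, hh0, u, v, huv⟩ := exists_C_mul_eq_of_not_dvd hmonic hprime hG
  have hroot : ∀ a : k, f.map (evalRingHom a) ≠ 0 := fun a => (hmonic.map _).ne_zero
  refine ((finite_setOfPred_isRoot hh0).biUnion fun a _ =>
    (finite_setOfPred_isRoot (hroot a)).image (Prod.mk a)).subset ?_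
  rintro ⟨a, b⟩ ⟨hf, hG⟩
  have ha : h.eval a = 0 := by
    have := congrArg (evalEval a b) huv
    simpa only [evalEval_C, evalEval_add, evalEval_mul, hf, hG, zero_mul, add_zero] using this
  refine Set.mem_biUnion ha ⟨b, ?_, rfl⟩
  rwa [Set.mem_ofPred_eq, IsRoot, map_evalRingHom_eval]

theorem irreducible_Y_pow_three_add (h3 : (3 : k) ≠ 0) :
    Irreducible (X ^ 3 + C (X ^ 3 + 1) : k[X][X]) := by
  have hprime : Prime (X + 1 : k[X]) := by simpa using prime_X_sub_C (-1 : k)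
  have hP : (Ideal.span {(X + 1 : k[X])}).IsPrime :=
    (Ideal.span_singleton_prime hprime.ne_zero).2 hprime
  have hdeg : (X ^ 3 + C (X ^ 3 + 1) : k[X][X]).degree = 3 := degree_X_pow_add_C (by norm_num) _
  have hmonic : (X ^ 3 + C (X ^ 3 + 1) : k[X][X]).Monic := monic_X_pow_add_C _ (by norm_num)
  have hcoeff : ∀ n < 3, (X ^ 3 + C (X ^ 3 + 1) : k[X][X]).coeff n =
      if n = 0 then X ^ 3 + 1 else 0 := by
    intro n hn
    rw [coeff_add, coeff_X_pow, coeff_C, if_neg (by lia), zero_add]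
  refine irreducible_of_eisenstein_criterion hP ?_ ?_ ?_ ?_ hmonic.isPrimitive
  · rw [hmonic.leadingCoeff, ← Ideal.eq_top_iff_one]
    exact hP.ne_top
  · intro n hn
    rw [hdeg] at hn
    rw [Ideal.mem_span_singleton, hcoeff n (by exact_mod_cast hn)]
    split_ifs
    · exact ⟨X ^ 2 - X + 1, by ring⟩
    · exact dvd_zero _
  · rw [hdeg]
    norm_num
  · rw [Ideal.span_singleton_pow, Ideal.mem_span_singleton, hcoeff 0 (by norm_num), if_pos rfl]
    rintro ⟨g, hg⟩
    have hder := congrArg (fun f => (derivative f).eval (-1)) hg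
    refine h3 ?_
    simpa [derivative_mul, derivative_pow] using hder

theorem exists_irreducible_evalEval_eq_zero_iff (k : Type*) [Field k] :
    ∃ f : k[X][X], f.Monic ∧ Irreducible f ∧
      ∀ a b, f.evalEval a b = 0 ↔ a ^ 3 + b ^ 3 + 1 = 0 := by
  by_cases h3 : (3 : k) = 0
  · -- In characteristic `3` the Fermat cubic is the cube of a line.
    refine ⟨X - C (-X - 1), monic_X_sub_C _, irreducible_X_sub_C _, fun a b => ?_⟩
    have hcube : a ^ 3 + b ^ 3 + 1 = (a + b + 1) ^ 3 := by
      linear_combination (-(a ^ 2 * b + a * b ^ 2 + a ^ 2 + a + b ^ 2 + b + 2 * a * b)) * h3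
    rw [hcube, pow_eq_zero_iff three_ne_zero]
    simp only [evalEval_sub, evalEval_X, evalEval_C, eval_sub, eval_neg, eval_X, eval_one]
    rw [show b - (-a - 1) = a + b + 1 by ring]
  · refine ⟨X ^ 3 + C (X ^ 3 + 1), monic_X_pow_add_C _ three_ne_zero,
      irreducible_Y_pow_three_add h3, fun a b => ?_⟩
    simp only [evalEval_add, evalEval_pow, evalEval_X, evalEval_C, eval_add, eval_pow, eval_X,
      eval_one]
    rw [show b ^ 3 + (a ^ 3 + 1) = a ^ 3 + b ^ 3 + 1 by ring]

theorem finite_zeros_or_eq_zero_on_affine_fermatCubic (G : k[X][X]) :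
    {p : k × k | p.1 ^ 3 + p.2 ^ 3 + 1 = 0 ∧ G.evalEval p.1 p.2 = 0}.Finite ∨
      ∀ a b : k, a ^ 3 + b ^ 3 + 1 = 0 → G.evalEval a b = 0 := by
  obtain ⟨f, hmonic, hirr, hf⟩ := exists_irreducible_evalEval_eq_zero_iff k
  by_cases hG : f ∣ G
  · obtain ⟨u, rfl⟩ := hG
    exact .inr fun a b hab => by rw [evalEval_mul, (hf a b).2 hab, zero_mul]
  · simp only [← hf]
    exact .inl (finite_common_zeros_of_not_dvd hmonic hirr.prime hG)

/-- The affine cone over the Fermat cubic, without its vertex. -/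
def fermatCubicCone (k : Type*) [Field k] : Set (Fin 3 → k) :=
  {r | r ≠ 0 ∧ ∑ j, r j ^ 3 = 0}

/-- The affine chart of the Fermat cubic where the `i`-th coordinate is `1`. -/
def fermatCubicChart (k : Type*) [Field k] (i : Fin 3) : Set (Fin 3 → k) :=
  {r | r i = 1 ∧ ∑ j, r j ^ 3 = 0}

/-- The vector with coordinates `1, a, b` in cyclic order, starting at the index `i`; it gives
affine coordinates `a, b` on the chart `fermatCubicChart k i`. -/
def chartVector {R : Type*} [One R] (i : Fin 3) (a b : R) (j : Fin 3) : R :=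
  if j = i then 1 else if j = i + 1 then a else b

theorem sum_chartVector_pow (i : Fin 3) (a b : k) :
    ∑ j, chartVector i a b j ^ 3 = a ^ 3 + b ^ 3 + 1 := by
  fin_cases i <;> simp [chartVector, Fin.sum_univ_three] <;> ring

theorem eq_chartVector {i : Fin 3} {r : Fin 3 → k} (h : r i = 1) :
    r = chartVector i (r (i + 1)) (r (i + 2)) := by
  funext j
  fin_cases i <;> fin_cases j <;> simp_all [chartVector]

theorem fermatCubicChart_eq_image (i : Fin 3) : fermatCubicChart k i =
    (fun p : k × k => chartVector i p.1 p.2) '' {p | p.1 ^ 3 + p.2 ^ 3 + 1 = 0} := by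
  ext r
  constructor
  · rintro ⟨hi, hr⟩
    refine ⟨(r (i + 1), r (i + 2)), ?_, (eq_chartVector hi).symm⟩
    rwa [eq_chartVector hi, sum_chartVector_pow] at hr
  · rintro ⟨p, hp, rfl⟩
    exact ⟨by simp [chartVector], by rwa [sum_chartVector_pow]⟩

theorem evalEval_aeval_chartVector (G : MvPolynomial (Fin 3) k) (i : Fin 3) (a b : k) :
    evalEval a b (MvPolynomial.aeval (chartVector i (C X) X) G) =
      MvPolynomial.eval (chartVector i a b) G := by
  induction G using MvPolynomial.induction_on with
  | C c => simp
  | add p q hp hq => simp only [map_add, evalEval_add, hp, hq]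
  | mul_X p j hp =>
    simp only [map_mul, evalEval_mul, hp, MvPolynomial.aeval_X, MvPolynomial.eval_X, chartVector]
    split_ifs <;> simp only [evalEval_one, evalEval_C, evalEval_X, eval_X]

theorem finite_zeros_or_eq_zero_on_fermatCubicChart (G : MvPolynomial (Fin 3) k) (i : Fin 3) :
    {r ∈ fermatCubicChart k i | MvPolynomial.eval r G = 0}.Finite ∨
      ∀ r ∈ fermatCubicChart k i, MvPolynomial.eval r G = 0 := by
  rw [fermatCubicChart_eq_image]
  refine (finite_zeros_or_eq_zero_on_affine_fermatCubic
    (MvPolynomial.aeval (chartVector i (C X) (X : k[X][X])) G)).imp (fun hfin => ?_) ?_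
  · refine (hfin.image fun p : k × k => chartVector i p.1 p.2).subset ?_
    rintro _ ⟨⟨p, hp, rfl⟩, hp0⟩
    exact ⟨p, ⟨hp, (evalEval_aeval_chartVector G i p.1 p.2).trans hp0⟩, rfl⟩
  · rintro h _ ⟨p, hp, rfl⟩
    exact (evalEval_aeval_chartVector G i p.1 p.2).symm.trans (h _ _ hp)

theorem infinite_fermatCubicChart [IsAlgClosed k] (i : Fin 3) :
    (fermatCubicChart k i).Infinite := by
  have : Infinite k := IsAlgClosed.instInfinite
  have hcube : ∀ a : k, ∃ b : k, b ^ 3 = -(a ^ 3 + 1) := fun a =>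
    IsAlgClosed.exists_pow_nat_eq _ three_pos
  choose b hb using hcube
  refine Set.infinite_of_injective_forall_mem (f := fun a => chartVector i a (b a)) ?_ fun a => ?_
  · intro a a' h
    have := congrFun h (i + 1)
    fin_cases i <;> simpa [chartVector] using this
  · rw [fermatCubicChart_eq_image]
    exact ⟨(a, b a), by simp only [Set.mem_ofPred_eq, hb]; ring, rfl⟩

theorem finite_fermatCubicChart_eq_zero (i j : Fin 3) :
    {r ∈ fermatCubicChart k i | r j = 0}.Finite := by
  have hroots : {b : k | b ^ 3 = -1}.Finite := by
    refine (finite_setOfPred_isRoot (X_pow_sub_C_ne_zero three_pos (-1 : k))).subset fun b hb => ?_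
    simp [show b ^ 3 = -1 from hb]
  refine ((hroots.image fun b => chartVector i 0 b).union
    (hroots.image fun b => chartVector i b 0)).subset ?_
  rw [fermatCubicChart_eq_image]
  rintro _ ⟨⟨⟨a, b⟩, hab, rfl⟩, h0⟩
  simp only [Set.mem_ofPred_eq, chartVector] at hab h0
  split_ifs at h0 with hi hi'
  · exact absurd h0 one_ne_zero
  · exact .inl ⟨b, show b ^ 3 = -1 by rw [h0] at hab; linear_combination hab, by rw [h0]⟩
  · exact .inr ⟨a, show a ^ 3 = -1 by rw [h0] at hab; linear_combination hab, by rw [h0]⟩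

theorem fermatCubicChart_subset_fermatCubicCone (i : Fin 3) :
    fermatCubicChart k i ⊆ fermatCubicCone k := fun _ hr =>
  ⟨fun h => by simpa [h] using hr.1, hr.2⟩

theorem smul_mem_fermatCubicCone {r : Fin 3 → k} (hr : r ∈ fermatCubicCone k) {c : k}
    (hc : c ≠ 0) : c • r ∈ fermatCubicCone k :=
  ⟨smul_ne_zero hc hr.1, by simp [mul_pow, ← Finset.mul_sum, hr.2]⟩

theorem exists_smul_mem_fermatCubicChart {r : Fin 3 → k} (hr : r ∈ fermatCubicCone k) :
    ∃ i, ∃ c : k, c ≠ 0 ∧ c • r ∈ fermatCubicChart k i := by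
  obtain ⟨i, hi⟩ := Function.ne_iff.1 hr.1
  exact ⟨i, (r i)⁻¹, inv_ne_zero hi, inv_mul_cancel₀ hi,
    (smul_mem_fermatCubicCone hr (inv_ne_zero hi)).2⟩

theorem finite_zeros_or_eq_zero_on_fermatCubicCone [IsAlgClosed k] {G : MvPolynomial (Fin 3) k}
    (hG : ∀ r ∈ fermatCubicCone k, ∀ c : k, c ≠ 0 → MvPolynomial.eval r G = 0 →
      MvPolynomial.eval (c • r) G = 0) :
    (∃ S : Set (Fin 3 → k), S.Finite ∧ ∀ r ∈ fermatCubicCone k, MvPolynomial.eval r G = 0 →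
      ∃ c : k, c ≠ 0 ∧ c • r ∈ S) ∨
    ∀ r ∈ fermatCubicCone k, MvPolynomial.eval r G = 0 := by
  by_cases h : ∃ i, ∀ r ∈ fermatCubicChart k i, MvPolynomial.eval r G = 0
  · obtain ⟨i, hi⟩ := h
    have hzero : ∀ r ∈ fermatCubicCone k, r i ≠ 0 → MvPolynomial.eval r G = 0 := by
      intro r hr hri
      have hr' := smul_mem_fermatCubicCone hr (inv_ne_zero hri)
      simpa only [smul_inv_smul₀ hri] using
        hG _ hr' (r i) hri (hi _ ⟨inv_mul_cancel₀ hri, hr'.2⟩)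
    have hchart : ∀ j, ∀ r ∈ fermatCubicChart k j, MvPolynomial.eval r G = 0 := by
      intro j
      refine (finite_zeros_or_eq_zero_on_fermatCubicChart G j).resolve_left fun hfin =>
        infinite_fermatCubicChart j ((hfin.union (finite_fermatCubicChart_eq_zero j i)).subset ?_)
      intro r hr
      by_cases hri : r i = 0
      · exact .inr ⟨hr, hri⟩
      · exact .inl ⟨hr, hzero r (fermatCubicChart_subset_fermatCubicCone j hr) hri⟩
    refine .inr fun r hr => ?_
    obtain ⟨j, c, hc, hcr⟩ := exists_smul_mem_fermatCubicChart hr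
    simpa only [inv_smul_smul₀ hc] using
      hG _ (smul_mem_fermatCubicCone hr hc) c⁻¹ (inv_ne_zero hc) (hchart j _ hcr)
  · push Not at h
    refine .inl ⟨⋃ i, {r ∈ fermatCubicChart k i | MvPolynomial.eval r G = 0},
      Set.finite_iUnion fun i =>
        (finite_zeros_or_eq_zero_on_fermatCubicChart G i).resolve_right fun h' => ?_,
      fun r hr hr0 => ?_⟩
    · obtain ⟨r, hr, hr0⟩ := h i
      exact hr0 (h' r hr)
    · obtain ⟨i, c, hc, hcr⟩ := exists_smul_mem_fermatCubicChart hr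
      exact ⟨c, hc, Set.mem_iUnion.2 ⟨i, hcr, hG r hr c hc hr0⟩⟩

end FermatCubic

section Cyclic

theorem exists_linearEquiv_of_span_singleton_eq_top {R M N : Type*} [Ring R] [AddCommGroup M]
    [AddCommGroup N] [Module R M] [Module R N] {x : M} {y : N} (hx : Submodule.span R {x} = ⊤)
    (hy : Submodule.span R {y} = ⊤) (h : ∀ r : R, r • x = 0 ↔ r • y = 0) :
    ∃ e : M ≃ₗ[R] N, ∀ r : R, e (r • x) = r • y := by
  let f := LinearMap.toSpanSingleton R M x
  let g := LinearMap.toSpanSingleton R N y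
  have hf : Function.Surjective f := fun m =>
    Submodule.mem_span_singleton.1 (hx ▸ Submodule.mem_top)
  have hg : Function.Surjective g := fun n =>
    Submodule.mem_span_singleton.1 (hy ▸ Submodule.mem_top)
  have hker : LinearMap.ker f = LinearMap.ker g := Submodule.ext h
  refine ⟨(f.quotKerEquivOfSurjective hf).symm.trans
    ((Submodule.quotEquivOfEq _ _ hker).trans (g.quotKerEquivOfSurjective hg)), fun r => ?_⟩
  have hr : (f.quotKerEquivOfSurjective hf).symm (r • x) = Submodule.Quotient.mk r :=
    (LinearEquiv.symm_apply_eq _).2 rfl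
  rw [LinearEquiv.trans_apply, hr]
  rfl

theorem exists_smul_eq_of_forall_mul_eq_mul {α k : Type*} [Field k] {u v : α → k} (hu : u ≠ 0)
    (hv : v ≠ 0) (h : ∀ i j, u i * v j = u j * v i) : ∃ c : k, c ≠ 0 ∧ v = c • u := by
  obtain ⟨i, hi⟩ := Function.ne_iff.1 hu
  have hvi : v = ((u i)⁻¹ * v i) • u := by
    funext j
    rw [Pi.smul_apply, smul_eq_mul, mul_assoc, mul_comm (v i), ← h, inv_mul_cancel_left₀ hi]
  refine ⟨_, fun h0 => hv ?_, hvi⟩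
  rw [hvi, h0, zero_smul]

end Cyclic

section Multihomogeneous

variable {k C ι : Type*} [Field k] [Ring C] [Algebra k C] {𝒞 : ι → Submodule k C}

theorem IsMultihomogeneous.eval_scale {p : MvPolynomial (Σ d, 𝒞 d) k} (hp : IsMultihomogeneous p) :
    ∃ n : ι →₀ ℕ, ∀ (c : ι → k) (φ : (Σ d, 𝒞 d) → k),
      MvPolynomial.eval (fun s => c s.1 * φ s) p = (n.prod fun d e => c d ^ e) *
        MvPolynomial.eval φ p := by
  obtain ⟨n, hn⟩ := hp
  refine ⟨n, fun c φ => ?_⟩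
  rw [MvPolynomial.eval_eq, MvPolynomial.eval_eq, Finset.mul_sum]
  refine Finset.sum_congr rfl fun m hm => ?_
  have hw := hn (MvPolynomial.mem_support_iff.1 hm)
  have hprod : ∏ s ∈ m.support, c s.1 ^ m s = n.prod fun d e => c d ^ e := by
    rw [← hw, Finsupp.weight_apply, Finsupp.prod_sum_index (by simp) (by intros; rw [pow_add])]
    refine Finset.prod_congr rfl fun s _ => ?_
    simp only [Finsupp.smul_single]
    rw [Finsupp.prod_single_index (by simp)]
    simp
  simp only [mul_pow, Finset.prod_mul_distrib]
  rw [hprod]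
  ring

theorem isMultihomogeneous_C_mul_X_sub_C_mul_X {d : ι} (a b : 𝒞 d) (x y : k) :
    IsMultihomogeneous (MvPolynomial.C x * MvPolynomial.X ⟨d, a⟩ -
      MvPolynomial.C y * MvPolynomial.X ⟨d, b⟩ : MvPolynomial (Σ d, 𝒞 d) k) := by
  refine ⟨Finsupp.single d 1, ?_⟩
  have h : ∀ (x : k) (a : 𝒞 d), MvPolynomial.IsWeightedHomogeneous
      (fun s : (Σ d, 𝒞 d) => Finsupp.single s.1 1)
      (MvPolynomial.C x * MvPolynomial.X ⟨d, a⟩) (Finsupp.single d 1) := fun x a => by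
    simpa using (MvPolynomial.isWeightedHomogeneous_C _ x).mul
      (MvPolynomial.isWeightedHomogeneous_X k (fun s : (Σ d, 𝒞 d) => Finsupp.single s.1 1) ⟨d, a⟩)
  exact (MvPolynomial.weightedHomogeneousSubmodule k _ _).sub_mem (h x a) (h y b)

end Multihomogeneous

section PointModuleTheory

universe u v w

variable {k : Type u} [Field k] {C : Type v} [Ring C] [Algebra k C]
  {ι : Type w} [AddMonoid ι] [DecidableEq ι] {𝒞 : ι → Submodule k C}

open MulOpposite

/-- The point of the moduli space given by a point module. -/
def PointModuli.mk (M : PointModule 𝒞) : PointModuli 𝒞 :=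
  Quotient.mk (PointModule.setoid 𝒞) M

theorem PointModuli.mk_surjective : Function.Surjective (mk : PointModule 𝒞 → PointModuli 𝒞) :=
  Quotient.mk_surjective

namespace PointModule

theorem exists_smul_eq (M : PointModule 𝒞) {d : ι} {m n : M.carrier} (hm : m ∈ M.comp d)
    (hm0 : m ≠ 0) (hn : n ∈ M.comp d) : ∃ c : k, n = c • m := by
  have h0 : (⟨m, hm⟩ : M.comp d) ≠ 0 := fun h => hm0 (congrArg Subtype.val h)
  obtain ⟨c, hc⟩ := (finrank_eq_one_iff_of_nonzero' _ h0).1 (M.finrank_comp d) ⟨n, hn⟩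
  exact ⟨c, (congrArg Subtype.val hc).symm⟩

theorem exists_ne_zero (M : PointModule 𝒞) (d : ι) : ∃ m, m ∈ M.comp d ∧ m ≠ 0 := by
  obtain ⟨⟨m, hm⟩, h0, -⟩ := finrank_eq_one_iff'.1 (M.finrank_comp d)
  exact ⟨m, hm, fun h => h0 (Subtype.ext h)⟩

theorem op_smul_mem (M : PointModule 𝒞) {d : ι} {m : M.carrier} {a : C} (hm : m ∈ M.comp 0)
    (ha : a ∈ 𝒞 d) : op a • m ∈ M.comp d := by
  simpa using M.smul_mem hm ha

theorem span_singleton_eq_top (M : PointModule 𝒞) {m : M.carrier} (hm : m ∈ M.comp 0)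
    (hm0 : m ≠ 0) : Submodule.span Cᵐᵒᵖ {m} = ⊤ := by
  obtain ⟨g, hg, hspan⟩ := M.cyclic
  obtain ⟨c, rfl⟩ := M.exists_smul_eq hm hm0 hg
  rw [eq_top_iff, ← hspan, Submodule.span_singleton_le_iff_mem]
  exact Submodule.smul_of_tower_mem _ c (Submodule.mem_span_singleton_self m)

theorem exists_op_smul_eq (hC : ⨆ d, 𝒞 d = ⊤) (M : PointModule 𝒞) {d : ι} {m n : M.carrier}
    (hm : m ∈ M.comp 0) (hm0 : m ≠ 0) (hn : n ∈ M.comp d) : ∃ a ∈ 𝒞 d, op a • m = n := by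
  obtain ⟨a, rfl⟩ := Submodule.mem_span_singleton.1
    (M.span_singleton_eq_top hm hm0 ▸ Submodule.mem_top (x := n))
  have ha : a.unop ∈ ⨆ d, 𝒞 d := hC ▸ Submodule.mem_top
  obtain ⟨f, hf, hfa⟩ := (Submodule.mem_iSup_iff_exists_finsupp _ _).1 ha
  have hsum : a • m - op (f d) • m = ∑ e ∈ f.support.erase d, op (f e) • m := by
    rw [← op_unop a, ← hfa, Finsupp.sum, Finset.op_sum, Finset.sum_smul, sub_eq_iff_eq_add]
    by_cases hd : d ∈ f.support
    · rw [Finset.sum_erase_add _ _ hd]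
    · rw [Finset.erase_eq_of_notMem hd, Finsupp.notMem_support_iff.1 hd, op_zero, zero_smul,
        add_zero]
  refine ⟨f d, hf d, (sub_eq_zero.1 (Submodule.disjoint_def.1
    (M.isInternal.submodule_iSupIndep d) _ (sub_mem hn (M.op_smul_mem hm (hf d))) ?_)).symm⟩
  rw [hsum]
  exact Submodule.sum_mem _ fun e he => Submodule.mem_iSup_of_mem e
    (Submodule.mem_iSup_of_mem (Finset.ne_of_mem_erase he) (M.op_smul_mem hm (hf e)))

theorem linearIndependent_of_mem_comp (M : PointModule 𝒞) {m : ι → M.carrier}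
    (hm : ∀ d, m d ∈ M.comp d ∧ m d ≠ 0) : LinearIndependent k m :=
  M.isInternal.submodule_iSupIndep.linearIndependent _ (fun d => (hm d).1) (fun d => (hm d).2)

theorem op_sum_smul_eq_zero_iff (M : PointModule 𝒞) {m : ι → M.carrier} {φ : (Σ d, 𝒞 d) → k}
    (hm : ∀ d, m d ∈ M.comp d ∧ m d ≠ 0)
    (hφ : ∀ d (a : 𝒞 d), op (a : C) • m 0 = φ ⟨d, a⟩ • m d) {f : ι →₀ C} (hf : ∀ d, f d ∈ 𝒞 d) :
    op (f.sum fun _ a => a) • m 0 = 0 ↔ ∀ d ∈ f.support, φ ⟨d, f d, hf d⟩ = 0 := by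
  have hsum : op (f.sum fun _ a => a) • m 0 = ∑ d ∈ f.support, φ ⟨d, f d, hf d⟩ • m d := by
    rw [Finsupp.sum, Finset.op_sum, Finset.sum_smul]
    exact Finset.sum_congr rfl fun d _ => hφ d ⟨f d, hf d⟩
  rw [hsum]
  exact ⟨linearIndependent_iff'.1 (M.linearIndependent_of_mem_comp hm) _ _,
    fun h => Finset.sum_eq_zero fun d hd => by rw [h d hd, zero_smul]⟩

theorem exists_isCoord (M : PointModule 𝒞) : ∃ φ, M.IsCoord φ := by
  choose m hm using M.exists_ne_zero
  choose φ hφ using fun s : (Σ d, 𝒞 d) =>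
    M.exists_smul_eq (hm s.1).1 (hm s.1).2 (M.op_smul_mem (hm 0).1 s.2.2)
  exact ⟨φ, m, hm, fun d a => hφ ⟨d, a⟩⟩

namespace IsCoord

variable {M N : PointModule 𝒞} {φ ψ : (Σ d, 𝒞 d) → k}

theorem exists_ne_zero (hC : ⨆ d, 𝒞 d = ⊤) (hφ : M.IsCoord φ) (d : ι) :
    (fun a => φ ⟨d, a⟩) ≠ 0 := by
  obtain ⟨m, hm, hφ⟩ := hφ
  obtain ⟨a, ha, had⟩ := M.exists_op_smul_eq hC (hm 0).1 (hm 0).2 (hm d).1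
  intro h
  refine (hm d).2 ?_
  rw [← had, hφ d ⟨a, ha⟩, show φ ⟨d, a, ha⟩ = 0 from congrFun h ⟨a, ha⟩, zero_smul]

theorem exists_scale (hφ : M.IsCoord φ) (hψ : N.IsCoord ψ) (h : M.Iso N) :
    ∃ c : ι → k, (∀ d, c d ≠ 0) ∧ ∀ s, ψ s = c s.1 * φ s := by
  obtain ⟨e, he⟩ := h
  obtain ⟨m, hm, hφ⟩ := hφ
  obtain ⟨n, hn, hψ⟩ := hψ
  choose c hc using fun d => N.exists_smul_eq (hn d).1 (hn d).2 ((he d _).1 (hm d).1)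
  have hc0 : ∀ d, c d ≠ 0 := by
    intro d h
    have hcd := hc d
    rw [h, zero_smul, e.map_eq_zero_iff] at hcd
    exact (hm d).2 hcd
  refine ⟨fun d => (c 0)⁻¹ * c d, fun d => mul_ne_zero (inv_ne_zero (hc0 0)) (hc0 d), ?_⟩
  rintro ⟨d, a⟩
  have hsmul := congrArg e (hφ d a)
  rw [map_smul, hc, smul_comm, hψ, ← algebraMap_smul Cᵐᵒᵖ (φ ⟨d, a⟩), map_smul, algebraMap_smul, hc,
    smul_smul, smul_smul] at hsmul
  rw [mul_assoc, eq_inv_mul_iff_mul_eq₀ (hc0 0), smul_left_injective k (hn d).2 hsmul, mul_comm]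

theorem iso (hC : ⨆ d, 𝒞 d = ⊤) (hφ : M.IsCoord φ) (hψ : N.IsCoord ψ) {c : ι → k}
    (hc : ∀ d, c d ≠ 0) (h : ∀ s, ψ s = c s.1 * φ s) : M.Iso N := by
  obtain ⟨m, hm, hφ⟩ := hφ
  obtain ⟨n, hn, hψ⟩ := hψ
  have hker : ∀ a : Cᵐᵒᵖ, a • m 0 = 0 ↔ a • n 0 = 0 := by
    intro a
    have ha : a.unop ∈ ⨆ d, 𝒞 d := hC ▸ Submodule.mem_top
    obtain ⟨f, hf, hfa⟩ := (Submodule.mem_iSup_iff_exists_finsupp _ _).1 ha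
    rw [← op_unop a, ← hfa, M.op_sum_smul_eq_zero_iff hm hφ hf, N.op_sum_smul_eq_zero_iff hn hψ hf]
    exact forall₂_congr fun d _ => by rw [h, mul_eq_zero_iff_left (hc d)]
  obtain ⟨e, he⟩ := exists_linearEquiv_of_span_singleton_eq_top
    (M.span_singleton_eq_top (hm 0).1 (hm 0).2) (N.span_singleton_eq_top (hn 0).1 (hn 0).2) hker
  refine ⟨e, fun d x => ⟨fun hx => ?_, fun hx => ?_⟩⟩
  · obtain ⟨a, ha, rfl⟩ := M.exists_op_smul_eq hC (hm 0).1 (hm 0).2 hx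
    rw [he]
    exact N.op_smul_mem (hn 0).1 ha
  · obtain ⟨a, ha, hax⟩ := N.exists_op_smul_eq hC (hn 0).1 (hn 0).2 hx
    rw [← he] at hax
    rw [← e.injective hax]
    exact M.op_smul_mem (hm 0).1 ha

theorem mk_eq_mk_iff (hC : ⨆ d, 𝒞 d = ⊤) (hφ : M.IsCoord φ) (hψ : N.IsCoord ψ) :
    PointModuli.mk M = PointModuli.mk N ↔
      ∃ c : ι → k, (∀ d, c d ≠ 0) ∧ ∀ s, ψ s = c s.1 * φ s :=
  ⟨fun h => hφ.exists_scale hψ (Quotient.exact h),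
    fun ⟨_, hc, h⟩ => Quotient.sound (hφ.iso hC hψ hc h)⟩

theorem mk_mem_basicOpen_iff (hφ : M.IsCoord φ) {p : MvPolynomial (Σ d, 𝒞 d) k}
    (hp : IsMultihomogeneous p) :
    PointModuli.mk M ∈ PointModuli.basicOpen 𝒞 p ↔
      MvPolynomial.eval φ p ≠ 0 := by
  refine ⟨?_, fun h => ⟨M, φ, rfl, hφ, h⟩⟩
  rintro ⟨N, ψ, hN, hψ, hp0⟩ h
  obtain ⟨c, -, hcs⟩ := hφ.exists_scale hψ (Quotient.exact hN.symm)
  obtain ⟨n, hn⟩ := hp.eval_scale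
  apply hp0
  rw [show ψ = fun s => c s.1 * φ s from funext hcs, hn, h, mul_zero]

end IsCoord

end PointModule

namespace PointModuli

theorem isClosed_compl_basicOpen {p : MvPolynomial (Σ d, 𝒞 d) k} (hp : IsMultihomogeneous p) :
    IsClosed (basicOpen 𝒞 p)ᶜ :=
  isClosed_compl_iff.2 (TopologicalSpace.isOpen_generateFrom_of_mem ⟨p, hp, rfl⟩)

theorem t1Space (hC : ⨆ d, 𝒞 d = ⊤) : T1Space (PointModuli 𝒞) := by
  refine ⟨fun z => ?_⟩
  obtain ⟨M, rfl⟩ := mk_surjective z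
  obtain ⟨φ, hφ⟩ := M.exists_isCoord
  let p (d : ι) (a b : 𝒞 d) : MvPolynomial (Σ d, 𝒞 d) k := MvPolynomial.C (φ ⟨d, a⟩) *
    MvPolynomial.X ⟨d, b⟩ - MvPolynomial.C (φ ⟨d, b⟩) * MvPolynomial.X ⟨d, a⟩
  have hp : ∀ d a b, IsMultihomogeneous (p d a b) := fun d a b =>
    isMultihomogeneous_C_mul_X_sub_C_mul_X _ _ _ _
  have heq : ({mk M} : Set (PointModuli 𝒞)) =
      ⋂ (d) (a) (b), (basicOpen 𝒞 (p d a b))ᶜ := by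
    refine Set.Subset.antisymm ?_ fun z hz => ?_
    · refine Set.singleton_subset_iff.2 (Set.mem_iInter₂.2 fun d a => Set.mem_iInter.2 fun b => ?_)
      rw [Set.mem_compl_iff, hφ.mk_mem_basicOpen_iff (hp d a b), not_not]
      simp [p, mul_comm]
    · obtain ⟨N, rfl⟩ := mk_surjective z
      obtain ⟨ψ, hψ⟩ := N.exists_isCoord
      have hprop : ∀ d, ∃ c : k, c ≠ 0 ∧ (fun a => ψ ⟨d, a⟩) = c • fun a => φ ⟨d, a⟩ := fun d =>
        exists_smul_eq_of_forall_mul_eq_mul (hφ.exists_ne_zero hC d) (hψ.exists_ne_zero hC d)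
          fun a b => by
            have hab := Set.mem_iInter.1 (Set.mem_iInter₂.1 hz d a) b
            rw [Set.mem_compl_iff, hψ.mk_mem_basicOpen_iff (hp d a b), not_not] at hab
            simpa [p, sub_eq_zero] using hab
      choose c hc hcψ using hprop
      exact ((hφ.mk_eq_mk_iff hC hψ).2 ⟨c, hc, fun s => congrFun (hcψ s.1) s.2⟩).symm
  rw [heq]
  exact isClosed_iInter fun d => isClosed_iInter fun a => isClosed_iInter fun b =>
    isClosed_compl_basicOpen (hp d a b)

end PointModuli

/-- The restriction of a right action on `V` to an invariant subspace. -/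
def restrictAction {V : Type*} [AddCommGroup V] [Module k V]
    (ρ : C →ₐ[k] (Module.End k V)ᵐᵒᵖ) (S : Submodule k V)
    (hS : ∀ a, ∀ x ∈ S, unop (ρ a) x ∈ S) : C →ₐ[k] (Module.End k S)ᵐᵒᵖ :=
  AlgHom.ofLinearMap
    { toFun := fun a => op ((unop (ρ a)).restrict (hS a))
      map_add' := by intros; apply unop_injective; ext; simp
      map_smul' := by intros; apply unop_injective; ext; simp }
    (by apply unop_injective; ext; simp) (by intros; apply unop_injective; ext; simp)

@[simp]
theorem coe_unop_restrictAction_apply {V : Type*} [AddCommGroup V] [Module k V]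
    (ρ : C →ₐ[k] (Module.End k V)ᵐᵒᵖ) (S : Submodule k V)
    (hS : ∀ a, ∀ x ∈ S, unop (ρ a) x ∈ S) (a : C) (x : S) :
    (unop (restrictAction ρ S hS a) x : V) = unop (ρ a) x := rfl

namespace PointModule

theorem exists_isCoord_of_basis {W : Type v} [AddCommGroup W] [Module k W]
    (ρ : C →ₐ[k] (Module.End k W)ᵐᵒᵖ) (w : Module.Basis ι k W) {φ : (Σ d, 𝒞 d) → k}
    (hstep : ∀ d e, ∀ a ∈ 𝒞 e, unop (ρ a) (w d) ∈ Submodule.span k {w (d + e)})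
    (hφ : ∀ d (a : 𝒞 d), unop (ρ a) (w 0) = φ ⟨d, a⟩ • w d)
    (hne : ∀ d, (fun a => φ ⟨d, a⟩) ≠ 0) : ∃ M : PointModule 𝒞, M.IsCoord φ := by
  let _ : Module Cᵐᵒᵖ W := Module.compHom W (AlgHom.opComm ρ).toRingHom
  have hact (a : C) (x : W) : op a • x = unop (ρ a) x := rfl
  have htower : IsScalarTower k Cᵐᵒᵖ W := ⟨fun c a x => by
    induction a using MulOpposite.rec' with | _ a => ?_
    rw [← op_smul, hact, hact, map_smul, unop_smul, LinearMap.smul_apply]⟩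
  have hgen (d : ι) : w d ∈ Submodule.span Cᵐᵒᵖ {w 0} := by
    obtain ⟨a, ha⟩ := Function.ne_iff.1 (hne d)
    refine Submodule.mem_span_singleton.2 ⟨op ((φ ⟨d, a⟩)⁻¹ • (a : C)), ?_⟩
    rw [op_smul, smul_assoc, hact, hφ, inv_smul_smul₀ ha]
  have hcyclic : Submodule.span Cᵐᵒᵖ {w 0} = ⊤ := by
    refine eq_top_iff.2 fun x _ => ?_
    rw [← w.linearCombination_repr x, Finsupp.linearCombination_apply]
    exact Submodule.sum_mem _ fun d _ => Submodule.smul_of_tower_mem _ _ (hgen d)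
  refine ⟨{ carrier := W
            comp := fun d => Submodule.span k {w d}
            isInternal := DirectSum.isInternal_submodule_of_iSupIndep_of_iSup_eq_top
              w.linearIndependent.iSupIndep_span_singleton
              (by rw [← Submodule.span_range_eq_iSup, w.span_eq])
            smul_mem := fun d e m a hm ha => ?_
            cyclic := ⟨w 0, Submodule.mem_span_singleton_self _, hcyclic⟩
            finrank_comp := fun d => finrank_span_singleton (w.ne_zero d) },
    w, fun d => ⟨Submodule.mem_span_singleton_self _, w.ne_zero d⟩, hφ⟩
  obtain ⟨c, rfl⟩ := Submodule.mem_span_singleton.1 hm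
  rw [hact, map_smul]
  exact Submodule.smul_mem _ _ (hstep d e a ha)

theorem exists_isCoord_of_linearIndependent {V : Type v} [AddCommGroup V] [Module k V]
    (hC : ⨆ d, 𝒞 d = ⊤) (ρ : C →ₐ[k] (Module.End k V)ᵐᵒᵖ) {v : ι → V}
    (hv : LinearIndependent k v) {φ : (Σ d, 𝒞 d) → k}
    (hstep : ∀ d e, ∀ a ∈ 𝒞 e, unop (ρ a) (v d) ∈ Submodule.span k {v (d + e)})
    (hφ : ∀ d (a : 𝒞 d), unop (ρ a) (v 0) = φ ⟨d, a⟩ • v d)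
    (hne : ∀ d, (fun a => φ ⟨d, a⟩) ≠ 0) : ∃ M : PointModule 𝒞, M.IsCoord φ := by
  have hS (a : C) : Submodule.span k (Set.range v) ≤
      (Submodule.span k (Set.range v)).comap (unop (ρ a)) := by
    have ha : a ∈ ⨆ d, 𝒞 d := hC ▸ Submodule.mem_top
    refine Submodule.span_le.2 (Set.range_subset_iff.2 fun d => Submodule.mem_comap.2 ?_)
    induction ha using Submodule.iSup_induction' with
    | zero => simp
    | add a b _ _ ha hb =>
      rw [map_add, unop_add]
      exact add_mem ha hb
    | mem e a ha =>
      exact Submodule.span_mono (Set.singleton_subset_iff.2 (Set.mem_range_self _)) (hstep d e a ha)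
  have hw (d : ι) : (Module.Basis.span hv d : V) = v d :=
    congrArg Subtype.val (Module.Basis.span_apply hv d)
  refine exists_isCoord_of_basis (restrictAction ρ _ hS) (Module.Basis.span hv)
    (fun d e a ha => ?_) (fun d a => Subtype.ext ?_) hne
  · obtain ⟨c, hc⟩ := Submodule.mem_span_singleton.1 (hstep d e a ha)
    refine Submodule.mem_span_singleton.2 ⟨c, Subtype.ext ?_⟩
    rw [coe_unop_restrictAction_apply, Submodule.coe_smul, hw, hw, hc]
  · rw [coe_unop_restrictAction_apply, Submodule.coe_smul, hw, hw, hφ]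

end PointModule

end PointModuleTheory

section PointSequences

variable {k : Type*} [Field k] {n : ℕ}

/-- The sequences of vectors `P d` through which the generators can act on a point module
`⨁ k m_d` of the quantum polynomial ring killed by the Fermat element, by
`m_d · x_i = P d i • m_(d + 1)`. -/
structure IsPointSeq (q : Fin n → Fin n → k) (P : ℕ → Fin n → k) : Prop where
  ne_zero : ∀ d, P d ≠ 0
  comm : ∀ d i j, P d j * P (d + 1) i = q j i * (P d i * P (d + 1) j)
  fermat : ∀ d, ∑ i, ∏ t ∈ Finset.range n, P (d + t) i = 0

namespace IsPointSeq

variable {q : Fin n → Fin n → k} {P P' : ℕ → Fin n → k}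

theorem succ_apply_ne_zero (hP : IsPointSeq q P) {d : ℕ} {j : Fin n} (hj : P d j ≠ 0) :
    P (d + 1) j ≠ 0 := by
  intro h
  obtain ⟨i, hi⟩ := Function.ne_iff.1 (hP.ne_zero (d + 1))
  have hcomm := hP.comm d i j
  rw [h, mul_zero, mul_zero] at hcomm
  exact mul_ne_zero hj hi hcomm

theorem apply_ne_zero (hP : IsPointSeq q P) {j : Fin n} (hj : P 0 j ≠ 0) (d : ℕ) : P d j ≠ 0 := by
  induction d with
  | zero => exact hj
  | succ d ih => exact hP.succ_apply_ne_zero ih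

theorem exists_succ_eq_smul (hP : IsPointSeq q P) (hP' : IsPointSeq q P') {d : ℕ} {b : k}
    (hb : b ≠ 0) (h : P' d = b • P d) : ∃ c : k, c ≠ 0 ∧ P' (d + 1) = c • P (d + 1) := by
  obtain ⟨j, hj⟩ := Function.ne_iff.1 (hP.ne_zero d)
  have hPd (i : Fin n) : P' d i = b * P d i := congrFun h i
  have hj₁ := hP.succ_apply_ne_zero hj
  have hj₁' := hP'.succ_apply_ne_zero (j := j) (d := d) (by rw [hPd]; exact mul_ne_zero hb hj)
  refine ⟨P' (d + 1) j / P (d + 1) j, div_ne_zero hj₁' hj₁, funext fun i => ?_⟩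
  have hcomm : P d j * P' (d + 1) i = q j i * (P d i * P' (d + 1) j) := by
    apply mul_left_cancel₀ hb
    linear_combination hP'.comm d i j - P' (d + 1) i * hPd j + q j i * P' (d + 1) j * hPd i
  rw [Pi.smul_apply, smul_eq_mul, div_mul_eq_mul_div, eq_div_iff hj₁]
  apply mul_left_cancel₀ hj
  linear_combination P (d + 1) j * hcomm - P' (d + 1) j * hP.comm d i j

theorem exists_eq_smul (hP : IsPointSeq q P) (hP' : IsPointSeq q P') {c : k} (hc : c ≠ 0)
    (h : P' 0 = c • P 0) : ∃ b : ℕ → k, (∀ d, b d ≠ 0) ∧ ∀ d, P' d = b d • P d := by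
  suffices H : ∀ d, ∃ b : k, b ≠ 0 ∧ P' d = b • P d by
    choose b hb hPb using H
    exact ⟨b, hb, hPb⟩
  intro d
  induction d with
  | zero => exact ⟨c, hc, h⟩
  | succ d ih =>
    obtain ⟨b, hb, ih⟩ := ih
    exact hP.exists_succ_eq_smul hP' hb ih

theorem triple_eq_one (hP : IsPointSeq q P) {i j l : Fin n}
    (hi : P 0 i ≠ 0) (hj : P 0 j ≠ 0) (hl : P 0 l ≠ 0) : q i j * q j l * q l i = 1 := by
  have hne : P 0 i * P 1 i * (P 0 j * P 1 j) * (P 0 l * P 1 l) ≠ 0 := by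
    have hsq {i : Fin n} (hi : P 0 i ≠ 0) : P 0 i * P 1 i ≠ 0 :=
      mul_ne_zero hi (hP.succ_apply_ne_zero hi)
    exact mul_ne_zero (mul_ne_zero (hsq hi) (hsq hj)) (hsq hl)
  have hcomm (i j : Fin n) : q j i * (P 0 i * P 1 j) = P 0 j * P 1 i := (hP.comm 0 i j).symm
  apply mul_right_cancel₀ hne
  calc q i j * q j l * q l i * (P 0 i * P 1 i * (P 0 j * P 1 j) * (P 0 l * P 1 l))
      = (q i j * (P 0 j * P 1 i)) * (q j l * (P 0 l * P 1 j)) * (q l i * (P 0 i * P 1 l)) := by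
        ring
    _ = 1 * (P 0 i * P 1 i * (P 0 j * P 1 j) * (P 0 l * P 1 l)) := by
        rw [hcomm, hcomm, hcomm]
        ring

theorem apply_mul_apply_zero (hP : IsPointSeq q P) {s : Fin n} (hs : P 0 s ≠ 0) (d : ℕ)
    (i : Fin n) : P d i * P 0 s = q s i ^ d * P 0 i * P d s := by
  induction d with
  | zero => ring
  | succ d ih =>
    apply mul_left_cancel₀ (hP.apply_ne_zero hs d)
    linear_combination P 0 s * hP.comm d i s + q s i * P (d + 1) s * ih

theorem sum_pow_eq_zero (hP : IsPointSeq q P) {s : Fin n} (hs : P 0 s ≠ 0) :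
    ∑ i, q s i ^ (n * (n - 1) / 2) * P 0 i ^ n = 0 := by
  have hterm (i : Fin n) : (∏ t ∈ Finset.range n, P t i) * P 0 s ^ n =
      q s i ^ (n * (n - 1) / 2) * P 0 i ^ n * ∏ t ∈ Finset.range n, P t s := by
    have h := Finset.prod_congr rfl fun t (_ : t ∈ Finset.range n) =>
      hP.apply_mul_apply_zero hs t i
    rw [Finset.prod_mul_distrib, Finset.prod_mul_distrib, Finset.prod_mul_distrib,
      Finset.prod_pow_eq_pow_sum, Finset.sum_range_id] at h
    simpa only [Finset.prod_const, Finset.card_range] using h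
  have hfermat : ∑ i, ∏ t ∈ Finset.range n, P t i = 0 := by simpa only [zero_add] using hP.fermat 0
  have hne : ∏ t ∈ Finset.range n, P t s ≠ 0 :=
    Finset.prod_ne_zero_iff.2 fun t _ => hP.apply_ne_zero hs t
  apply mul_right_cancel₀ hne
  rw [Finset.sum_mul, ← Finset.sum_congr rfl fun i _ => hterm i, ← Finset.sum_mul, hfermat,
    zero_mul, zero_mul]

end IsPointSeq

/-- The sequence `d ↦ (t i ^ d * r i)ᵢ`, the shape of a point sequence with initial vector `r`. -/
def twistedSeq (t r : Fin n → k) (d : ℕ) (i : Fin n) : k := t i ^ d * r i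

@[simp]
theorem twistedSeq_zero (t r : Fin n → k) : twistedSeq t r 0 = r := by
  funext i
  simp [twistedSeq]

theorem isPointSeq_twistedSeq {q : Fin n → Fin n → k} (hq : IsQuantumParameter q) {s : Fin n}
    {r : Fin n → k} (hr : r ≠ 0)
    (htriple : ∀ i j, r i ≠ 0 → r j ≠ 0 → q s j * q j i * q i s = 1)
    (hsum : ∑ i, q s i ^ (n * (n - 1) / 2) * r i ^ n = 0) :
    IsPointSeq q (twistedSeq (q s) r) where
  ne_zero d := by
    obtain ⟨i, hi⟩ := Function.ne_iff.1 hr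
    exact Function.ne_iff.2
      ⟨i, mul_ne_zero (pow_ne_zero d (left_ne_zero_of_mul_eq_one (hq.mul_swap s i))) hi⟩
  comm d i j := by
    simp only [twistedSeq]
    by_cases hi : r i = 0
    · simp [hi]
    by_cases hj : r j = 0
    · simp [hj]
    have hsi : q s i = q j i * q s j := by
      linear_combination q s j * q j i * hq.mul_swap s i - q s i * htriple i j hi hj
    rw [pow_succ (q s i), hsi]
    ring
  fermat d := by
    rw [← hsum]
    refine Finset.sum_congr rfl fun i _ => ?_
    simp only [twistedSeq, Finset.prod_mul_distrib, Finset.prod_const, Finset.card_range, pow_add]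
    rw [Finset.prod_pow_eq_pow_sum, Finset.sum_range_id, ← pow_mul, mul_comm d n, pow_mul,
      hq.pow_eq_one, one_pow, one_mul]

end PointSequences

section Parameters

variable {k : Type*} [Field k] {n : ℕ}

namespace IsQuantumParameter

variable {q : Fin n → Fin n → k} (hq : IsQuantumParameter q)
include hq

theorem triple_eq_one_of_eq {i j l : Fin n} (h : i = j ∨ j = l ∨ l = i) :
    q i j * q j l * q l i = 1 := by
  rcases h with rfl | rfl | rfl <;> simp [hq.diag, hq.mul_swap]

theorem triple_swap_eq_one {i j l : Fin n} (h : q i j * q j l * q l i = 1) :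
    q j i * q i l * q l j = 1 := by
  calc q j i * q i l * q l j
      = (q i j * q j l * q l i) * (q j i * q i l * q l j) := by rw [h, one_mul]
    _ = (q i j * q j i) * (q j l * q l j) * (q l i * q i l) := by ring
    _ = 1 := by simp only [hq.mul_swap, mul_one]

theorem prod_triple_eq_one (h : IsCalabiYauParameter q) (i j : Fin n) :
    ∏ l, q i j * q j l * q l i = 1 := by
  rw [Finset.prod_mul_distrib, Finset.prod_mul_distrib, Finset.prod_const, h i j,
    Finset.card_univ, Fintype.card_fin, hq.pow_eq_one, one_mul, ← Finset.prod_mul_distrib]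
  exact Finset.prod_eq_one fun l _ => hq.mul_swap j l

theorem triple_eq_one_of_forall_ne (h : IsCalabiYauParameter q) {i j l : Fin n}
    (hne : ∀ m, m ≠ l → q i j * q j m * q m i = 1) : q i j * q j l * q l i = 1 := by
  rw [← hq.prod_triple_eq_one h i j]
  exact (Fintype.prod_eq_single l hne).symm

end IsQuantumParameter

theorem IsCalabiYauParameter.isSpecialParameter {q : Fin 3 → Fin 3 → k}
    (h : IsCalabiYauParameter q) (hq : IsQuantumParameter q) : IsSpecialParameter q := by
  intro i j l
  by_cases hdeg : i = j ∨ j = l ∨ l = i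
  · exact hq.triple_eq_one_of_eq hdeg
  · exact hq.triple_eq_one_of_forall_ne h fun m hm => hq.triple_eq_one_of_eq (by lia)

namespace IsCalabiYauParameter

variable {q : Fin 4 → Fin 4 → k} (h : IsCalabiYauParameter q) (hq : IsQuantumParameter q)
include h hq

theorem forall_triple_eq_one {i j l : Fin 4} (hij : i ≠ j) (hjl : j ≠ l) (hli : l ≠ i)
    (h₁ : q i j * q j l * q l i = 1) (m : Fin 4) : q i j * q j m * q m i = 1 := by
  by_cases hm : m = i ∨ m = j ∨ m = l
  · rcases hm with rfl | rfl | rfl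
    · exact hq.triple_eq_one_of_eq (.inr (.inr rfl))
    · exact hq.triple_eq_one_of_eq (.inr (.inl rfl))
    · exact h₁
  · refine hq.triple_eq_one_of_forall_ne h fun m' hm' => ?_
    obtain rfl | hdeg : m' = l ∨ i = j ∨ j = m' ∨ m' = i := by lia
    exacts [h₁, hq.triple_eq_one_of_eq hdeg]

theorem forall_triple_eq_one_of_forall {i j : Fin 4} (hij : i ≠ j)
    (h₁ : ∀ m, q i j * q j m * q m i = 1) (l m : Fin 4) : q j l * q l m * q m j = 1 := by
  rcases eq_or_ne l i with rfl | hli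
  · exact hq.triple_swap_eq_one (h₁ m)
  rcases eq_or_ne j l with hjl | hjl
  · exact hq.triple_eq_one_of_eq (.inl hjl)
  · exact h.forall_triple_eq_one hq hjl hli hij (by rw [← h₁ l]; ring) m

theorem triple_ne_one (hgen : IsGeneralParameter q) {i j l : Fin 4} (hij : i ≠ j)
    (hjl : j ≠ l) (hli : l ≠ i) : q i j * q j l * q l i ≠ 1 := by
  refine fun h₁ => hgen fun x y z => ?_
  have hj := h.forall_triple_eq_one_of_forall hq hij (h.forall_triple_eq_one hq hij hjl hli h₁)
  rcases eq_or_ne j x with rfl | hjx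
  · exact hj y z
  · exact h.forall_triple_eq_one_of_forall hq hjx (hj x) y z

end IsCalabiYauParameter

end Parameters

section PointSequencesThree

variable {k : Type*} [Field k] {q : Fin 3 → Fin 3 → k}

theorem isPointSeq_twistedSeq_of_mem_fermatCubicCone (hq : IsQuantumParameter q)
    (h : IsCalabiYauParameter q) {r : Fin 3 → k} (hr : r ∈ fermatCubicCone k) :
    IsPointSeq q (twistedSeq (q 0) r) :=
  isPointSeq_twistedSeq hq hr.1 (fun i j _ _ => h.isSpecialParameter hq 0 j i)
    (by simpa [hq.pow_eq_one] using hr.2)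

theorem IsPointSeq.mem_fermatCubicCone {R : ℕ → Fin 3 → k} (hR : IsPointSeq q R)
    (hq : IsQuantumParameter q) : R 0 ∈ fermatCubicCone k := by
  obtain ⟨j, hj⟩ := Function.ne_iff.1 (hR.ne_zero 0)
  exact ⟨hR.ne_zero 0, by simpa [hq.pow_eq_one] using hR.sum_pow_eq_zero hj⟩

end PointSequencesThree

section PointSequencesFour

variable {k : Type*} [Field k] {q : Fin 4 → Fin 4 → k} (hq : IsQuantumParameter q)
include hq

theorem exists_isPointSeq_four [IsAlgClosed k] : ∃ P, IsPointSeq q P := by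
  obtain ⟨c, hc⟩ : ∃ c : k, c ^ 4 = -q 0 1 ^ 2 := IsAlgClosed.exists_pow_nat_eq _ (by norm_num)
  have h₈ : q 0 1 ^ 8 = 1 := by
    rw [show 8 = 4 * 2 from rfl, pow_mul, hq.pow_eq_one, one_pow]
  refine ⟨_, isPointSeq_twistedSeq hq (s := 0) (r := ![1, c, 0, 0])
    (Function.ne_iff.2 ⟨0, by simp⟩) (fun i j hi hj => hq.triple_eq_one_of_eq ?_) ?_⟩
  · have hsupp {i : Fin 4} (hi : ![1, c, 0, 0] i ≠ 0) : i = 0 ∨ i = 1 := by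
      fin_cases i <;> simp_all
    have hi := hsupp hi
    have hj := hsupp hj
    lia
  · simp only [Fin.sum_univ_four, hq.diag, Nat.add_one_sub_one, Nat.reduceMul, Nat.reduceDiv,
      Matrix.cons_val, one_pow, mul_one, ne_eq, OfNat.ofNat_ne_zero, not_false_eq_true, zero_pow,
      mul_zero, add_zero]
    linear_combination q 0 1 ^ 6 * hc - h₈

theorem IsPointSeq.exists_smul_pow_eight_eq_one {P : ℕ → Fin 4 → k} (hP : IsPointSeq q P)
    (h : IsCalabiYauParameter q) (hgen : IsGeneralParameter q) :
    ∃ c : k, c ≠ 0 ∧ ∀ i, (c • P 0) i = 0 ∨ (c • P 0) i ^ 8 = 1 := by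
  obtain ⟨s, hs⟩ := Function.ne_iff.1 (hP.ne_zero 0)
  refine ⟨(P 0 s)⁻¹, inv_ne_zero hs, fun j => or_iff_not_imp_left.2 fun hj => ?_⟩
  have hj₀ : P 0 j ≠ 0 := fun h₀ => hj (by simp [h₀])
  rcases eq_or_ne j s with rfl | hjs
  · rw [Pi.smul_apply, smul_eq_mul, inv_mul_cancel₀ hj₀, one_pow]
  have hzero (l : Fin 4) (hl : l ≠ s ∧ l ≠ j) : P 0 l = 0 := by
    by_contra hl₀
    exact h.triple_ne_one hq hgen hjs.symm hl.2.symm hl.1 (hP.triple_eq_one hs hj₀ hl₀)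
  have hsum : P 0 s ^ 4 + q s j ^ 6 * P 0 j ^ 4 = 0 := by
    have := hP.sum_pow_eq_zero hs
    rw [Fintype.sum_eq_add s j hjs.symm fun l hl => by rw [hzero l hl]; ring] at this
    simpa [hq.diag] using this
  have hq₁₂ : q s j ^ 12 = 1 := by rw [show 12 = 4 * 3 from rfl, pow_mul, hq.pow_eq_one, one_pow]
  rw [Pi.smul_apply, smul_eq_mul, inv_mul_eq_div, div_pow, div_eq_one_iff_eq (pow_ne_zero 8 hs)]
  linear_combination (q s j ^ 6 * P 0 j ^ 4 - P 0 s ^ 4) * hsum - P 0 j ^ 8 * hq₁₂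

theorem exists_finite_isPointSeq_representatives (h : IsCalabiYauParameter q)
    (hgen : IsGeneralParameter q) :
    ∃ S : Set (ℕ → Fin 4 → k), S.Finite ∧ (∀ P ∈ S, IsPointSeq q P) ∧
      ∀ P, IsPointSeq q P → ∃ P' ∈ S, ∃ c : k, c ≠ 0 ∧ P' 0 = c • P 0 := by
  let V : Set (Fin 4 → k) := {v | ∀ i, v i = 0 ∨ v i ^ 8 = 1}
  let V' : Set (Fin 4 → k) := {v ∈ V | ∃ P, IsPointSeq q P ∧ ∃ c : k, c ≠ 0 ∧ P 0 = c • v}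
  have hV : V.Finite := by
    classical
    have hroots : {x : k | x ^ 8 = 1}.Finite :=
      (Polynomial.nthRoots 8 (1 : k)).toFinset.finite_toSet.subset fun x hx => by
        simpa [Polynomial.mem_nthRoots] using hx
    exact Set.Finite.pi' fun _ => (Set.finite_singleton 0).union hroots
  choose! f hf c hc hfc using fun v (hv : v ∈ V') => hv.2
  refine ⟨f '' V', (hV.subset (Set.sep_subset _ _)).image f, ?_, fun P hP => ?_⟩
  · rintro _ ⟨v, hv, rfl⟩
    exact hf v hv
  · obtain ⟨b, hb, hbP⟩ := hP.exists_smul_pow_eight_eq_one hq h hgen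
    have hv : b • P 0 ∈ V' := ⟨hbP, P, hP, b⁻¹, inv_ne_zero hb, (inv_smul_smul₀ hb _).symm⟩
    exact ⟨f (b • P 0), ⟨_, hv, rfl⟩, c (b • P 0) * b, mul_ne_zero (hc _ hv) hb, by
      rw [hfc _ hv, smul_smul]⟩

end PointSequencesFour

section Words

variable {k : Type*} [CommSemiring k] {α β : Type*}

/-- The product `c d i₀ * c (d + 1) i₁ * ⋯` of the entries of a sequence of vectors along a word
`[i₀, i₁, …]`: the scalar by which the word acts on `m_d` if its letters act by
`m_d · i = c d i • m_(d + 1)`. -/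
def wordVal (c : ℕ → α → k) : ℕ → List α → k
  | _, [] => 1
  | d, i :: l => c d i * wordVal c (d + 1) l

@[simp]
theorem wordVal_nil (c : ℕ → α → k) (d : ℕ) : wordVal c d [] = 1 := rfl

@[simp]
theorem wordVal_cons (c : ℕ → α → k) (d : ℕ) (i : α) (l : List α) :
    wordVal c d (i :: l) = c d i * wordVal c (d + 1) l := rfl

theorem wordVal_replicate (c : ℕ → α → k) (d n : ℕ) (i : α) :
    wordVal c d (List.replicate n i) = ∏ t ∈ Finset.range n, c (d + t) i := by
  induction n generalizing d with
  | zero => simp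
  | succ n ih => simp [List.replicate_succ, ih, Finset.prod_range_succ', mul_comm, add_assoc,
      add_comm 1]

theorem wordVal_smul (c : ℕ → α → k) (b : ℕ → k) (d : ℕ) (l : List α) :
    wordVal (fun e => b e • c e) d l =
      (∏ t ∈ Finset.range l.length, b (d + t)) * wordVal c d l := by
  induction l generalizing d with
  | nil => simp
  | cons i l ih =>
    simp only [wordVal_cons, ih, List.length_cons, Finset.prod_range_succ', add_zero,
      Pi.smul_apply, smul_eq_mul, add_assoc, add_comm 1]
    ring

theorem wordVal_prod (c : ℕ → α → k) (c' : ℕ → β → k) (d : ℕ) (l : List (α × β)) :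
    wordVal (fun e i => c e i.1 * c' e i.2) d l =
      wordVal c d (l.map Prod.fst) * wordVal c' d (l.map Prod.snd) := by
  induction l generalizing d with
  | nil => simp
  | cons i l ih =>
    simp only [wordVal_cons, ih, List.map_cons]
    ring

theorem exists_wordVal_ne_zero [NoZeroDivisors k] [Nontrivial k] {c : ℕ → α → k}
    (h : ∀ d, c d ≠ 0) (d n : ℕ) : ∃ l : List α, l.length = n ∧ wordVal c d l ≠ 0 := by
  induction n generalizing d with
  | zero => exact ⟨[], rfl, one_ne_zero⟩
  | succ n ih =>
    obtain ⟨i, hi⟩ := Function.ne_iff.1 (h d)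
    obtain ⟨l, hl, hl₀⟩ := ih (d + 1)
    exact ⟨i :: l, by simp [hl], mul_ne_zero hi hl₀⟩

theorem ne_zero_of_wordVal_ne_zero {c : ℕ → α → k} {d t : ℕ}
    {l : List α} (h : wordVal c d l ≠ 0) (ht : t < l.length) : c (d + t) ≠ 0 := by
  induction l generalizing d t with
  | nil => exact absurd ht t.not_lt_zero
  | cons i l ih =>
    rw [wordVal_cons] at h
    cases t with
    | zero => exact Function.ne_iff.2 ⟨i, left_ne_zero_of_mul h⟩
    | succ t =>
      rw [add_comm t, ← add_assoc]
      exact ih (right_ne_zero_of_mul h) (Nat.lt_of_succ_lt_succ ht)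

theorem map_wordVal {k' : Type*} [CommSemiring k'] (f : k →+* k') (c : ℕ → α → k) (d : ℕ)
    (l : List α) : f (wordVal c d l) = wordVal (fun e i => f (c e i)) d l := by
  induction l generalizing d with
  | nil => simp
  | cons i l ih => simp [ih]

end Words

section RightActions

variable {k C V α : Type*} [Field k] [Ring C] [Algebra k C] [AddCommGroup V] [Module k V]

open MulOpposite

/-- The linear map `a ↦ v · a` attached to a right action `ρ` of `C` on `V`. -/
def orbitMap (ρ : C →ₐ[k] (Module.End k V)ᵐᵒᵖ) (v : V) : C →ₗ[k] V :=
  LinearMap.applyₗ v ∘ₗ (opLinearEquiv k).symm.toLinearMap ∘ₗ ρ.toLinearMap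

theorem orbitMap_apply (ρ : C →ₐ[k] (Module.End k V)ᵐᵒᵖ) (v : V) (a : C) :
    orbitMap ρ v a = unop (ρ a) v := rfl

theorem orbitMap_mul (ρ : C →ₐ[k] (Module.End k V)ᵐᵒᵖ) (v : V) (a b : C) :
    orbitMap ρ v (a * b) = orbitMap ρ (orbitMap ρ v a) b := by
  simp [orbitMap_apply]

theorem orbitMap_smul (ρ : C →ₐ[k] (Module.End k V)ᵐᵒᵖ) (c : k) (v : V) (a : C) :
    orbitMap ρ (c • v) a = c • orbitMap ρ v a := by
  simp [orbitMap_apply]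

theorem orbitMap_prod_map {ρ : C →ₐ[k] (Module.End k V)ᵐᵒᵖ} {x : α → C} {m : ℕ → V}
    {c : ℕ → α → k} (h : ∀ d i, orbitMap ρ (m d) (x i) = c d i • m (d + 1)) (d : ℕ) (l : List α) :
    orbitMap ρ (m d) (l.map x).prod = wordVal c d l • m (d + l.length) := by
  induction l generalizing d with
  | nil => simp [orbitMap_apply]
  | cons i l ih =>
    rw [List.map_cons, List.prod_cons, orbitMap_mul, h, orbitMap_smul, ih, smul_smul, wordVal_cons,
      List.length_cons, add_assoc, add_comm 1]

end RightActions

namespace QuantumPoly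

universe u

variable {k : Type u} [Field k] {n : ℕ} (q : Fin n → Fin n → k)

theorem x_mul_x (i j : Fin n) : x q j * x q i = q j i • (x q i * x q j) := by
  have h := RingQuot.mkAlgHom_rel k (QuantumRel.comm (q := q) i j)
  rw [map_mul, map_smul, map_mul] at h
  exact h

/-- The homomorphism out of the quantum polynomial ring given by elements satisfying the
relations. -/
def lift {E : Type*} [Semiring E] [Algebra k E] (X : Fin n → E)
    (hX : ∀ i j, X j * X i = q j i • (X i * X j)) : QuantumPoly q →ₐ[k] E :=
  RingQuot.liftAlgHom k ⟨FreeAlgebra.lift k X, by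
    rintro _ _ ⟨i, j⟩
    simp [hX i j]⟩

@[simp]
theorem lift_x {E : Type*} [Semiring E] [Algebra k E] (X : Fin n → E)
    (hX : ∀ i j, X j * X i = q j i • (X i * X j)) (i : Fin n) : lift q X hX (x q i) = X i :=
  (RingQuot.liftAlgHom_mkAlgHom_apply k _ _ _).trans (FreeAlgebra.lift_ι_apply X i)

/-- The monomial attached to a word in the generators. -/
def word (l : List (Fin n)) : QuantumPoly q := (l.map (x q)).prod

theorem word_append (l l' : List (Fin n)) : word q (l ++ l') = word q l * word q l' := by
  simp [word]

theorem word_pair_swap (i j : Fin n) : word q [j, i] = q j i • word q [i, j] := by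
  simpa [word] using x_mul_x q i j

theorem fermat_eq_sum_word : fermat q = ∑ i, word q (List.replicate n i) := by
  simp [fermat, word]

theorem word_mem_deg (l : List (Fin n)) : word q l ∈ deg q l.length := by
  induction l with
  | nil => exact SetLike.GradedOne.one_mem
  | cons i l ih =>
    rw [word, List.map_cons, List.prod_cons, List.length_cons, deg, pow_succ']
    exact Submodule.mul_mem_mul (Submodule.subset_span ⟨i, rfl⟩) ih

theorem deg_eq_span (d : ℕ) : deg q d = Submodule.span k (word q '' {l | l.length = d}) := by
  refine le_antisymm ?_ (Submodule.span_le.2 ?_)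
  · rw [deg, Submodule.span_pow]
    refine Submodule.span_mono fun a ha => ?_
    obtain ⟨f, rfl⟩ := Set.mem_pow.1 ha
    choose i hi using fun t => (f t).2
    refine ⟨List.ofFn i, List.length_ofFn, ?_⟩
    rw [word, List.map_ofFn]
    exact congrArg (List.prod ∘ List.ofFn) (funext hi)
  · rintro _ ⟨l, rfl, rfl⟩
    exact word_mem_deg q l

theorem adjoin_range_x : Algebra.adjoin k (Set.range (x q)) = ⊤ := by
  let π : FreeAlgebra k (Fin n) →ₐ[k] QuantumPoly q := RingQuot.mkAlgHom k (QuantumRel q)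
  have hπ : Function.Surjective π := RingQuot.mkAlgHom_surjective k (QuantumRel q)
  have hx : Set.range (x q) = π '' Set.range (FreeAlgebra.ι k) := Set.range_comp π _
  rw [hx, ← AlgHom.map_adjoin, FreeAlgebra.adjoin_range_ι, Algebra.map_top,
    (AlgHom.range_eq_top π).2 hπ]

theorem iSup_deg : ⨆ d, deg q d = ⊤ := by
  rw [eq_top_iff, ← Algebra.top_toSubmodule, ← adjoin_range_x, Algebra.adjoin_eq_span,
    Submodule.span_le]
  intro a ha
  obtain ⟨d, hd⟩ : ∃ d, a ∈ deg q d := by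
    induction ha using Submonoid.closure_induction with
    | mem a ha => exact ⟨1, by rw [deg, pow_one]; exact Submodule.subset_span ha⟩
    | one => exact ⟨0, SetLike.GradedOne.one_mem⟩
    | mul a b _ _ ha hb =>
      obtain ⟨d, ha⟩ := ha
      obtain ⟨e, hb⟩ := hb
      exact ⟨d + e, SetLike.GradedMul.mul_mem ha hb⟩
  exact Submodule.mem_iSup_of_mem d hd

end QuantumPoly

section Actions

universe u

open MulOpposite QuantumPoly
open scoped TensorProduct

variable {k : Type u} [Field k]

/-- The right action of `A ⊗ B` on `V ⊗ W` given by right actions of `A` on `V` and of `B` on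
`W`. -/
def tensorRightAction {A B V W : Type*} [Ring A] [Algebra k A] [Ring B] [Algebra k B]
    [AddCommGroup V] [Module k V] [AddCommGroup W] [Module k W]
    (ρ : A →ₐ[k] (Module.End k V)ᵐᵒᵖ) (σ : B →ₐ[k] (Module.End k W)ᵐᵒᵖ) :
    A ⊗[k] B →ₐ[k] (Module.End k (V ⊗[k] W))ᵐᵒᵖ :=
  (AlgHom.op Module.endTensorEndAlgHom).comp
    ((Algebra.TensorProduct.opAlgEquiv k k (Module.End k V) (Module.End k W)).toAlgHom.comp
      (Algebra.TensorProduct.map ρ σ))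

variable {n m : ℕ} {q : Fin n → Fin n → k} {q' : Fin m → Fin m → k} {P : ℕ → Fin n → k}
  {R : ℕ → Fin m → k}

/-- The weighted shift `e_d ↦ c d • e_(d + 1)` of the free vector space with basis `e_d`,
`d ∈ ℕ`. -/
def weightedShift (c : ℕ → k) : Module.End k (ℕ →₀ k) :=
  Finsupp.linearCombination k fun d => c d • Finsupp.single (d + 1) 1

theorem weightedShift_single (c : ℕ → k) (d : ℕ) :
    weightedShift c (Finsupp.single d 1) = c d • Finsupp.single (d + 1) 1 := by
  simp only [weightedShift, Finsupp.linearCombination_single, one_smul]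

/-- The right action of the quantum polynomial ring on the free vector space with basis `e_d`,
`d ∈ ℕ`, attached to a point sequence: `e_d · x_i = P d i • e_(d + 1)`. -/
def seqAction (hP : IsPointSeq q P) : QuantumPoly q →ₐ[k] (Module.End k (ℕ →₀ k))ᵐᵒᵖ :=
  QuantumPoly.lift q (fun i => op (weightedShift (P · i))) fun i j =>
    unop_injective <| Finsupp.lhom_ext' fun d => LinearMap.ext_ring <| by
      change weightedShift (P · i) (weightedShift (P · j) (Finsupp.single d 1)) =
        q j i • weightedShift (P · j) (weightedShift (P · i) (Finsupp.single d 1))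
      simp only [weightedShift_single, map_smul, smul_smul, hP.comm d i j]

theorem orbitMap_seqAction_word (hP : IsPointSeq q P) (d : ℕ) (l : List (Fin n)) :
    orbitMap (seqAction hP) (Finsupp.single d 1) (word q l) =
      wordVal P d l • Finsupp.single (d + l.length) 1 :=
  orbitMap_prod_map (m := fun d => Finsupp.single d 1)
    (fun d i => by rw [orbitMap_apply, seqAction, lift_x, unop_op, weightedShift_single]) d l

theorem seqAction_fermat (hP : IsPointSeq q P) : seqAction hP (fermat q) = 0 := by
  refine unop_injective <| Finsupp.lhom_ext' fun d => LinearMap.ext_ring ?_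
  change orbitMap (seqAction hP) (Finsupp.single d 1) (fermat q) = 0
  simp only [fermat_eq_sum_word, map_sum, orbitMap_seqAction_word, wordVal_replicate,
    List.length_replicate, ← Finset.sum_smul, hP.fermat, zero_smul]

/-- The algebra `A ⊗ B / (f, g)`. -/
abbrev FermatTensor (q : Fin n → Fin n → k) (q' : Fin m → Fin m → k) : Type u :=
  (idealJ q q').ringCon.Quotient

/-- The bigrading of `A ⊗ B / (f, g)`. -/
abbrev fermatTensorDeg (q : Fin n → Fin n → k) (q' : Fin m → Fin m → k) :
    ℕ × ℕ → Submodule k (FermatTensor q q') :=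
  tensorQuotDeg (deg q) (deg q') (idealJ q q')

theorem mkₐ_eq_zero_of_mem_idealJ {z : QuantumPoly q ⊗[k] QuantumPoly q'} (hz : z ∈ idealJ q q') :
    (idealJ q q').ringCon.mkₐ k z = 0 :=
  (RingCon.eq _).2 ((TwoSidedIdeal.mem_iff _ _).1 hz)

/-- The right action of `A ⊗ B` on the free vector space with basis `e_(a, b)`, `a, b ∈ ℕ`, in
which `A` acts on the first index and `B` on the second one, by point sequences. -/
def seqPairAction (hP : IsPointSeq q P) (hR : IsPointSeq q' R) :
    QuantumPoly q ⊗[k] QuantumPoly q' →ₐ[k] (Module.End k (ℕ × ℕ →₀ k))ᵐᵒᵖ :=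
  (AlgHom.op ((finsuppTensorFinsupp' k ℕ ℕ).conjAlgEquiv k).toAlgHom).comp
    (tensorRightAction (seqAction hP) (seqAction hR))

theorem unop_seqPairAction_tmul (hP : IsPointSeq q P) (hR : IsPointSeq q' R) (a : QuantumPoly q)
    (b : QuantumPoly q') : unop (seqPairAction hP hR (a ⊗ₜ b)) =
      (finsuppTensorFinsupp' k ℕ ℕ).conjAlgEquiv k
        (TensorProduct.map (unop (seqAction hP a)) (unop (seqAction hR b))) := rfl

theorem idealJ_le_ker_seqPairAction (hP : IsPointSeq q P) (hR : IsPointSeq q' R) :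
    idealJ q q' ≤ TwoSidedIdeal.ker (seqPairAction hP hR) := by
  rw [idealJ, TwoSidedIdeal.span_le]
  rintro z (rfl | rfl) <;> refine (TwoSidedIdeal.mem_ker _).2 (unop_injective ?_) <;>
    rw [unop_seqPairAction_tmul] <;> simp [seqAction_fermat]

/-- The action `seqPairAction` of `A ⊗ B`, on its quotient `A ⊗ B / (f, g)`. -/
def tensorQuotAction (hP : IsPointSeq q P) (hR : IsPointSeq q' R) :
    FermatTensor q q' →ₐ[k] (Module.End k (ℕ × ℕ →₀ k))ᵐᵒᵖ :=
  RingCon.liftₐ _ (seqPairAction hP hR)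
    (TwoSidedIdeal.ringCon_le_iff.1 (idealJ_le_ker_seqPairAction hP hR))

variable (q q') in
/-- The monomial of `A ⊗ B / (f, g)` attached to a pair of words. -/
def tensorWord (l : List (Fin n)) (l' : List (Fin m)) : FermatTensor q q' :=
  (idealJ q q').ringCon.mkₐ k (word q l ⊗ₜ word q' l')

theorem orbitMap_tensorQuotAction_word (hP : IsPointSeq q P) (hR : IsPointSeq q' R) (d : ℕ × ℕ)
    (l : List (Fin n)) (l' : List (Fin m)) :
    orbitMap (tensorQuotAction hP hR) (Finsupp.single d 1) (tensorWord q q' l l') =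
      (wordVal P d.1 l * wordVal R d.2 l') • Finsupp.single (d + (l.length, l'.length)) 1 := by
  change unop (seqPairAction hP hR (word q l ⊗ₜ word q' l')) _ = _
  have hl := orbitMap_seqAction_word hP d.1 l
  have hl' := orbitMap_seqAction_word hR d.2 l'
  rw [orbitMap_apply] at hl hl'
  rw [unop_seqPairAction_tmul, LinearEquiv.conjAlgEquiv_apply_apply,
    finsuppTensorFinsupp'_symm_single_eq_single_one_tmul, TensorProduct.map_tmul, hl, hl',
    TensorProduct.smul_tmul_smul, map_smul, finsuppTensorFinsupp'_single_tmul_single, mul_one]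
  rfl

end Actions

section Monomials

universe u

open QuantumPoly
open scoped TensorProduct

variable {k : Type u} [Field k] {n m : ℕ} {q : Fin n → Fin n → k} {q' : Fin m → Fin m → k}

theorem tensorWord_mul (l r : List (Fin n)) (l' r' : List (Fin m)) :
    tensorWord q q' l l' * tensorWord q q' r r' = tensorWord q q' (l ++ r) (l' ++ r') := by
  simp only [tensorWord, ← map_mul, Algebra.TensorProduct.tmul_mul_tmul, word_append]

theorem tensorWord_pair_swap_left (i j : Fin n) (l' : List (Fin m)) :
    tensorWord q q' [j, i] l' = q j i • tensorWord q q' [i, j] l' := by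
  rw [tensorWord, word_pair_swap, ← TensorProduct.smul_tmul', map_smul, tensorWord]

theorem tensorWord_pair_swap_right (l : List (Fin n)) (i j : Fin m) :
    tensorWord q q' l [j, i] = q' j i • tensorWord q q' l [i, j] := by
  rw [tensorWord, word_pair_swap, TensorProduct.tmul_smul, map_smul, tensorWord]

theorem sum_tensorWord_replicate_left (l' : List (Fin m)) :
    ∑ i, tensorWord q q' (List.replicate n i) l' = 0 := by
  have h : fermat q ⊗ₜ[k] 1 * 1 ⊗ₜ word q' l' ∈ idealJ q q' :=
    TwoSidedIdeal.mul_mem_right _ _ _ (TwoSidedIdeal.subset_span (Or.inl rfl))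
  have h₀ := mkₐ_eq_zero_of_mem_idealJ h
  rwa [Algebra.TensorProduct.tmul_mul_tmul, mul_one, one_mul, fermat_eq_sum_word,
    TensorProduct.sum_tmul, map_sum] at h₀

theorem sum_tensorWord_replicate_right (l : List (Fin n)) :
    ∑ i, tensorWord q q' l (List.replicate m i) = 0 := by
  have h : word q l ⊗ₜ[k] 1 * 1 ⊗ₜ fermat q' ∈ idealJ q q' :=
    TwoSidedIdeal.mul_mem_left _ _ _ (TwoSidedIdeal.subset_span (Or.inr rfl))
  have h₀ := mkₐ_eq_zero_of_mem_idealJ h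
  rwa [Algebra.TensorProduct.tmul_mul_tmul, mul_one, one_mul, fermat_eq_sum_word,
    TensorProduct.tmul_sum, map_sum] at h₀

variable (q q')

theorem tensorDeg_eq_span (d : ℕ × ℕ) : tensorDeg (deg q) (deg q') d =
    Submodule.span k (Set.image2 (fun l l' => word q l ⊗ₜ[k] word q' l')
      {l | l.length = d.1} {l' | l'.length = d.2}) := by
  rw [tensorDeg, TensorProduct.range_map, Submodule.range_subtype, Submodule.range_subtype,
    deg_eq_span, deg_eq_span, Submodule.map₂_span_span, Set.image2_image_left,
    Set.image2_image_right]
  rfl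

theorem fermatTensorDeg_eq_span (d : ℕ × ℕ) :
    fermatTensorDeg q q' d = Submodule.span k
      (Set.image2 (tensorWord q q') {l | l.length = d.1} {l' | l'.length = d.2}) := by
  rw [fermatTensorDeg, tensorQuotDeg, tensorDeg_eq_span, Submodule.map_span, Set.image_image2]
  rfl

theorem tensorWord_mem_fermatTensorDeg (l : List (Fin n)) (l' : List (Fin m)) :
    tensorWord q q' l l' ∈ fermatTensorDeg q q' (l.length, l'.length) := by
  rw [fermatTensorDeg_eq_span]
  exact Submodule.subset_span ⟨l, rfl, l', rfl, rfl⟩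

theorem iSup_tensorDeg : ⨆ d, tensorDeg (deg q) (deg q') d = ⊤ := by
  have h (d : ℕ × ℕ) : tensorDeg (deg q) (deg q') d =
      Submodule.map₂ (TensorProduct.mk k _ _) (deg q d.1) (deg q' d.2) := by
    rw [tensorDeg, TensorProduct.range_map, Submodule.range_subtype, Submodule.range_subtype]
  simp only [h, iSup_prod, ← Submodule.map₂_iSup_right, ← Submodule.map₂_iSup_left, iSup_deg,
    TensorProduct.map₂_mk_top_top_eq_top]

theorem iSup_fermatTensorDeg : ⨆ d, fermatTensorDeg q q' d = ⊤ := by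
  simp only [fermatTensorDeg, tensorQuotDeg, ← Submodule.map_iSup, iSup_tensorDeg,
    Submodule.map_top]
  exact LinearMap.range_eq_top.2 (RingCon.mkₐ_surjective (α := k) _)

variable {q q'}

theorem fermatTensorDeg_le {d : ℕ × ℕ} {S : Submodule k (FermatTensor q q')}
    (h : ∀ l l', l.length = d.1 → l'.length = d.2 → tensorWord q q' l l' ∈ S) :
    fermatTensorDeg q q' d ≤ S := by
  rw [fermatTensorDeg_eq_span, Submodule.span_le]
  rintro _ ⟨l, hl, l', hl', rfl⟩
  exact h l l' hl hl'

end Monomials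

section Forms

universe u

variable {k : Type u} [Field k] {n m : ℕ} {q : Fin n → Fin n → k} {q' : Fin m → Fin m → k}
  {P : ℕ → Fin n → k} {R : ℕ → Fin m → k}

/-- The linear form on `A ⊗ B / (f, g)` whose restriction to degree `d` is the coordinate form in
degree `d` of the point module attached to a pair of point sequences. -/
def tensorForm (hP : IsPointSeq q P) (hR : IsPointSeq q' R) (d : ℕ × ℕ) :
    FermatTensor q q' →ₗ[k] k :=
  Finsupp.lapply d ∘ₗ orbitMap (tensorQuotAction hP hR) (Finsupp.single 0 1)

theorem tensorForm_word (hP : IsPointSeq q P) (hR : IsPointSeq q' R) {d : ℕ × ℕ}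
    {l : List (Fin n)} {l' : List (Fin m)} (hl : l.length = d.1) (hl' : l'.length = d.2) :
    tensorForm hP hR d (tensorWord q q' l l') = wordVal P 0 l * wordVal R 0 l' := by
  rw [tensorForm, LinearMap.comp_apply, orbitMap_tensorQuotAction_word, zero_add, hl, hl']
  simp

theorem orbitMap_tensorQuotAction_mem_span (hP : IsPointSeq q P) (hR : IsPointSeq q' R)
    (d : ℕ × ℕ) {e : ℕ × ℕ} {a : FermatTensor q q'} (ha : a ∈ fermatTensorDeg q q' e) :
    orbitMap (tensorQuotAction hP hR) (Finsupp.single d 1) a ∈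
      Submodule.span k {Finsupp.single (d + e) 1} := by
  suffices h : fermatTensorDeg q q' e ≤ (Submodule.span k {Finsupp.single (d + e) 1}).comap
      (orbitMap (tensorQuotAction hP hR) (Finsupp.single d 1)) from h ha
  refine fermatTensorDeg_le fun l l' hl hl' => ?_
  rw [Submodule.mem_comap, orbitMap_tensorQuotAction_word, hl, hl']
  exact Submodule.smul_mem _ _ (Submodule.mem_span_singleton_self _)

theorem orbitMap_tensorQuotAction_zero (hP : IsPointSeq q P) (hR : IsPointSeq q' R) {d : ℕ × ℕ}
    {a : FermatTensor q q'} (ha : a ∈ fermatTensorDeg q q' d) :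
    orbitMap (tensorQuotAction hP hR) (Finsupp.single 0 1) a =
      tensorForm hP hR d a • Finsupp.single d 1 := by
  obtain ⟨c, hc⟩ := Submodule.mem_span_singleton.1 (orbitMap_tensorQuotAction_mem_span hP hR 0 ha)
  rw [zero_add] at hc
  rw [tensorForm, LinearMap.comp_apply, ← hc]
  simp

theorem exists_tensorForm_ne_zero (hP : IsPointSeq q P) (hR : IsPointSeq q' R) (d : ℕ × ℕ) :
    ∃ a ∈ fermatTensorDeg q q' d, tensorForm hP hR d a ≠ 0 := by
  obtain ⟨l, hl, hl₀⟩ := exists_wordVal_ne_zero hP.ne_zero 0 d.1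
  obtain ⟨l', hl', hl'₀⟩ := exists_wordVal_ne_zero hR.ne_zero 0 d.2
  refine ⟨tensorWord q q' l l', ?_, ?_⟩
  · simpa only [hl, hl'] using tensorWord_mem_fermatTensorDeg q q' l l'
  · rw [tensorForm_word hP hR hl hl']
    exact mul_ne_zero hl₀ hl'₀

theorem exists_tensorForm_eq_mul {P' : ℕ → Fin n → k} {R' : ℕ → Fin m → k} (hP : IsPointSeq q P)
    (hR : IsPointSeq q' R) (hP' : IsPointSeq q P') (hR' : IsPointSeq q' R') {b c : k}
    (hb : b ≠ 0) (hc : c ≠ 0) (hPP' : P' 0 = b • P 0) (hRR' : R' 0 = c • R 0) (d : ℕ × ℕ) :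
    ∃ e : k, e ≠ 0 ∧ ∀ a ∈ fermatTensorDeg q q' d,
      tensorForm hP' hR' d a = e * tensorForm hP hR d a := by
  obtain ⟨β, hβ, hPβ⟩ := hP.exists_eq_smul hP' hb hPP'
  obtain ⟨γ, hγ, hRγ⟩ := hR.exists_eq_smul hR' hc hRR'
  refine ⟨(∏ t ∈ Finset.range d.1, β t) * ∏ t ∈ Finset.range d.2, γ t,
    mul_ne_zero (Finset.prod_ne_zero_iff.2 fun t _ => hβ t)
      (Finset.prod_ne_zero_iff.2 fun t _ => hγ t), fun a ha => ?_⟩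
  refine fermatTensorDeg_le (S := LinearMap.eqLocus (tensorForm hP' hR' d)
    (((∏ t ∈ Finset.range d.1, β t) * ∏ t ∈ Finset.range d.2, γ t) • tensorForm hP hR d))
    (fun l l' hl hl' => ?_) ha
  rw [LinearMap.mem_eqLocus, LinearMap.smul_apply, tensorForm_word _ _ hl hl',
    tensorForm_word _ _ hl hl', funext hPβ, funext hRγ, wordVal_smul, wordVal_smul, hl, hl']
  simp only [zero_add, smul_eq_mul]
  ring

theorem exists_tensorForm_eq_eval {X : Type*} (hP : IsPointSeq q P) (t : Fin m → k)
    {r : X → Fin m → k} (hr : ∀ x, IsPointSeq q' (twistedSeq t (r x))) {d : ℕ × ℕ}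
    {a : FermatTensor q q'} (ha : a ∈ fermatTensorDeg q q' d) :
    ∃ G : MvPolynomial (Fin m) k, ∀ x, tensorForm hP (hr x) d a = MvPolynomial.eval (r x) G := by
  let Φ : FermatTensor q q' →ₗ[k] X → k := LinearMap.pi fun x => tensorForm hP (hr x) d
  let Ψ : MvPolynomial (Fin m) k →ₗ[k] X → k :=
    LinearMap.pi fun x => (MvPolynomial.aeval (r x)).toLinearMap
  suffices h : fermatTensorDeg q q' d ≤ (LinearMap.range Ψ).comap Φ by
    obtain ⟨G, hG⟩ := h ha
    exact ⟨G, fun x => (congrFun hG x).symm⟩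
  refine fermatTensorDeg_le fun l l' hl hl' => ⟨MvPolynomial.C (wordVal P 0 l) *
    wordVal (fun d i => MvPolynomial.C (t i ^ d) * MvPolynomial.X i) 0 l', funext fun x => ?_⟩
  change MvPolynomial.eval (r x) _ = tensorForm hP (hr x) d (tensorWord q q' l l')
  rw [tensorForm_word hP _ hl hl', map_mul, map_wordVal (MvPolynomial.eval (r x)),
    MvPolynomial.eval_C]
  simp only [map_mul, MvPolynomial.eval_C, MvPolynomial.eval_X]
  rfl

end Forms

section Parametrization

universe u w

open MvPolynomial

variable {k C : Type u} [Field k] [Ring C] [Algebra k C] {ι : Type w} [AddMonoid ι] [DecidableEq ι]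
  {n m : ℕ} {q : Fin n → Fin n → k} {q' : Fin m → Fin m → k}

/-- The coordinates, on a graded algebra `C` mapping to `A ⊗ B / (f, g)` by `f`, of the point
module attached to a pair of point sequences; degree `d` of `C` is placed in bidegree `δ d`. -/
def tensorCoord {P : ℕ → Fin n → k} {R : ℕ → Fin m → k} (𝒞 : ι → Submodule k C)
    (f : C →ₐ[k] FermatTensor q q') (δ : ι →+ ℕ × ℕ) (hP : IsPointSeq q P)
    (hR : IsPointSeq q' R) : (Σ d, 𝒞 d) → k :=
  fun s => tensorForm hP hR (δ s.1) (f s.2)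

/-- `C` is the part of `A ⊗ B / (f, g)` in the bidegrees `δ d`, up to the map `f`, and all its
point modules come from pairs of point sequences. This is the common ground of
`A ⊗ B / J`, where `δ` is the identity, and of `A ∘ B / J_Δ`, where `δ` is the diagonal. -/
structure IsPointSeqParametrized (𝒞 : ι → Submodule k C) (f : C →ₐ[k] FermatTensor q q')
    (δ : ι →+ ℕ × ℕ) : Prop where
  iSup_eq_top : ⨆ d, 𝒞 d = ⊤
  map_eq : ∀ d, (𝒞 d).map f.toLinearMap = fermatTensorDeg q q' (δ d)
  injective : Function.Injective δ
  exists_eq_one : ∃ D, δ D = (1, 1)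
  exists_coord : ∀ (M : PointModule 𝒞) (φ : (Σ d, 𝒞 d) → k), M.IsCoord φ →
    ∃ (P : ℕ → Fin n → k) (R : ℕ → Fin m → k) (hP : IsPointSeq q P) (hR : IsPointSeq q' R)
      (c : ι → k), (∀ d, c d ≠ 0) ∧ ∀ s, φ s = c s.1 * tensorCoord 𝒞 f δ hP hR s

namespace IsPointSeqParametrized

variable {𝒞 : ι → Submodule k C} {f : C →ₐ[k] FermatTensor q q'} {δ : ι →+ ℕ × ℕ}
  {P P' : ℕ → Fin n → k} {R R' : ℕ → Fin m → k}

theorem apply_mem (h : IsPointSeqParametrized 𝒞 f δ) {d : ι} {a : C} (ha : a ∈ 𝒞 d) :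
    f a ∈ fermatTensorDeg q q' (δ d) :=
  h.map_eq d ▸ Submodule.mem_map_of_mem ha

theorem exists_isCoord_tensorCoord (h : IsPointSeqParametrized 𝒞 f δ) (hP : IsPointSeq q P)
    (hR : IsPointSeq q' R) : ∃ M : PointModule 𝒞, M.IsCoord (tensorCoord 𝒞 f δ hP hR) := by
  have hstep (d e : ι) (a : C) (ha : a ∈ 𝒞 e) :
      orbitMap (tensorQuotAction hP hR) (Finsupp.single (δ d) 1) (f a) ∈
        Submodule.span k {Finsupp.single (δ (d + e)) 1} :=
    map_add δ d e ▸ orbitMap_tensorQuotAction_mem_span hP hR (δ d) (h.apply_mem ha)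
  have hform (d : ι) (a : 𝒞 d) :
      orbitMap (tensorQuotAction hP hR) (Finsupp.single (δ 0) 1) (f a) =
        tensorCoord 𝒞 f δ hP hR ⟨d, a⟩ • Finsupp.single (δ d) 1 :=
    (map_zero δ).symm ▸ orbitMap_tensorQuotAction_zero hP hR (h.apply_mem a.2)
  have hv := (Finsupp.linearIndependent_single_one k (ℕ × ℕ)).comp δ h.injective
  refine PointModule.exists_isCoord_of_linearIndependent h.iSup_eq_top
    ((tensorQuotAction hP hR).comp f) hv hstep hform fun d => ?_
  obtain ⟨_, hb, hb₀⟩ := exists_tensorForm_ne_zero hP hR (δ d)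
  obtain ⟨a, ha, rfl⟩ := (h.map_eq d).ge hb
  exact Function.ne_iff.2 ⟨⟨a, ha⟩, hb₀⟩

/-- The point of the moduli space attached to a pair of point sequences. -/
def point (h : IsPointSeqParametrized 𝒞 f δ) (hP : IsPointSeq q P) (hR : IsPointSeq q' R) :
    PointModuli 𝒞 :=
  PointModuli.mk (h.exists_isCoord_tensorCoord hP hR).choose

theorem point_mem_basicOpen_iff (h : IsPointSeqParametrized 𝒞 f δ) (hP : IsPointSeq q P)
    (hR : IsPointSeq q' R) {p : MvPolynomial (Σ d, 𝒞 d) k} (hp : IsMultihomogeneous p) :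
    h.point hP hR ∈ PointModuli.basicOpen 𝒞 p ↔ eval (tensorCoord 𝒞 f δ hP hR) p ≠ 0 :=
  (h.exists_isCoord_tensorCoord hP hR).choose_spec.mk_mem_basicOpen_iff hp

theorem exists_eq_point (h : IsPointSeqParametrized 𝒞 f δ) (z : PointModuli 𝒞) :
    ∃ (P : ℕ → Fin n → k) (R : ℕ → Fin m → k) (hP : IsPointSeq q P) (hR : IsPointSeq q' R),
      z = h.point hP hR := by
  obtain ⟨M, rfl⟩ := PointModuli.mk_surjective z
  obtain ⟨φ, hφ⟩ := M.exists_isCoord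
  obtain ⟨P, R, hP, hR, c, hc, hφc⟩ := h.exists_coord M φ hφ
  have hN := (h.exists_isCoord_tensorCoord hP hR).choose_spec
  exact ⟨P, R, hP, hR, ((hN.mk_eq_mk_iff h.iSup_eq_top hφ).2 ⟨c, hc, hφc⟩).symm⟩

theorem exists_tensorCoord_eq_mul (h : IsPointSeqParametrized 𝒞 f δ) :
    ∃ (D : ι) (e : Fin n → Fin m → 𝒞 D), ∀ (P : ℕ → Fin n → k) (R : ℕ → Fin m → k)
      (hP : IsPointSeq q P) (hR : IsPointSeq q' R) (i : Fin n) (j : Fin m),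
      tensorCoord 𝒞 f δ hP hR ⟨D, e i j⟩ = P 0 i * R 0 j := by
  obtain ⟨D, hD⟩ := h.exists_eq_one
  have hmem (i j) : tensorWord q q' [i] [j] ∈ (𝒞 D).map f.toLinearMap := by
    rw [h.map_eq, hD]
    exact tensorWord_mem_fermatTensorDeg q q' [i] [j]
  choose e he hfe using hmem
  refine ⟨D, fun i j => ⟨e i j, he i j⟩, fun P R hP hR i j => ?_⟩
  change tensorForm hP hR (δ D) (f.toLinearMap (e i j)) = _
  rw [hfe, hD, tensorForm_word hP hR rfl rfl]
  simp

theorem point_eq_point_iff (h : IsPointSeqParametrized 𝒞 f δ) (hP : IsPointSeq q P)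
    (hR : IsPointSeq q' R) (hP' : IsPointSeq q P') (hR' : IsPointSeq q' R') :
    h.point hP hR = h.point hP' hR' ↔
      (∃ b : k, b ≠ 0 ∧ P' 0 = b • P 0) ∧ ∃ c : k, c ≠ 0 ∧ R' 0 = c • R 0 := by
  have hφ := (h.exists_isCoord_tensorCoord hP hR).choose_spec
  have hφ' := (h.exists_isCoord_tensorCoord hP' hR').choose_spec
  refine (hφ.mk_eq_mk_iff h.iSup_eq_top hφ').trans ⟨?_, ?_⟩
  · rintro ⟨c, -, hc⟩
    obtain ⟨D, e, he⟩ := h.exists_tensorCoord_eq_mul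
    have hPR (i j) : P' 0 i * R' 0 j = c D * (P 0 i * R 0 j) := by
      rw [← he P R hP hR, ← he P' R' hP' hR', hc]
    obtain ⟨i₀, hi₀⟩ := Function.ne_iff.1 (hP'.ne_zero 0)
    obtain ⟨j₀, hj₀⟩ := Function.ne_iff.1 (hR'.ne_zero 0)
    refine ⟨exists_smul_eq_of_forall_mul_eq_mul (hP.ne_zero 0) (hP'.ne_zero 0) fun i i' => ?_,
      exists_smul_eq_of_forall_mul_eq_mul (hR.ne_zero 0) (hR'.ne_zero 0) fun j j' => ?_⟩
    · exact mul_right_cancel₀ hj₀ (by linear_combination P 0 i * hPR i' j₀ - P 0 i' * hPR i j₀)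
    · exact mul_left_cancel₀ hi₀ (by linear_combination R 0 j * hPR i₀ j' - R 0 j' * hPR i₀ j)
  · rintro ⟨⟨b, hb, hPb⟩, c, hc, hRc⟩
    choose e he heq using fun d =>
      exists_tensorForm_eq_mul hP hR hP' hR' hb hc hPb hRc (δ d)
    exact ⟨e, he, fun s => heq s.1 _ (h.apply_mem s.2.2)⟩

/-- The locus in the moduli space where the first point sequence is fixed, up to scalars, and the
second one varies. -/
def curve (h : IsPointSeqParametrized 𝒞 f δ) (hP : IsPointSeq q P) : Set (PointModuli 𝒞) :=
  {z | ∃ (R : ℕ → Fin m → k) (hR : IsPointSeq q' R), z = h.point hP hR}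

theorem point_mem_curve_iff (h : IsPointSeqParametrized 𝒞 f δ) (hP : IsPointSeq q P)
    (hP' : IsPointSeq q P') (hR' : IsPointSeq q' R') :
    h.point hP' hR' ∈ h.curve hP ↔ ∃ b : k, b ≠ 0 ∧ P 0 = b • P' 0 := by
  constructor
  · rintro ⟨R, hR, hz⟩
    exact ((h.point_eq_point_iff _ _ _ _).1 hz).1
  · intro hb
    exact ⟨R', hR', (h.point_eq_point_iff _ _ _ _).2 ⟨hb, 1, one_ne_zero, (one_smul _ _).symm⟩⟩

theorem isClosed_curve (h : IsPointSeqParametrized 𝒞 f δ) (hP : IsPointSeq q P) :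
    IsClosed (h.curve hP) := by
  obtain ⟨D, e, he⟩ := h.exists_tensorCoord_eq_mul
  let p (i i' : Fin n) (j : Fin m) : MvPolynomial (Σ d, 𝒞 d) k :=
    MvPolynomial.C (P 0 i') * X ⟨D, e i j⟩ - MvPolynomial.C (P 0 i) * X ⟨D, e i' j⟩
  have hp (i i' j) : IsMultihomogeneous (p i i' j) :=
    isMultihomogeneous_C_mul_X_sub_C_mul_X _ _ _ _
  have hcurve : h.curve hP = ⋂ (i) (i') (j), (PointModuli.basicOpen 𝒞 (p i i' j))ᶜ := by
    ext z
    obtain ⟨P', R', hP', hR', rfl⟩ := h.exists_eq_point z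
    simp only [h.point_mem_curve_iff, Set.mem_iInter, Set.mem_compl_iff,
      h.point_mem_basicOpen_iff _ _ (hp _ _ _), not_not, p, map_sub, map_mul, eval_C, eval_X, he]
    constructor
    · rintro ⟨b, -, hb⟩ i i' j
      simp only [hb, Pi.smul_apply, smul_eq_mul]
      ring
    · intro hz
      obtain ⟨j, hj⟩ := Function.ne_iff.1 (hR'.ne_zero 0)
      exact exists_smul_eq_of_forall_mul_eq_mul (hP'.ne_zero 0) (hP.ne_zero 0) fun i i' =>
        mul_right_cancel₀ hj (by linear_combination hz i i' j)
  rw [hcurve]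
  exact isClosed_iInter fun i => isClosed_iInter fun i' => isClosed_iInter fun j =>
    PointModuli.isClosed_compl_basicOpen (hp i i' j)

end IsPointSeqParametrized

end Parametrization

section Dimension

universe u w

open MvPolynomial

variable {k C : Type u} [Field k] [Ring C] [Algebra k C] {ι : Type w} [AddMonoid ι] [DecidableEq ι]

namespace IsPointSeqParametrized

variable {n : ℕ} {q : Fin n → Fin n → k} {q' : Fin 3 → Fin 3 → k}
  {𝒞 : ι → Submodule k C} {f : C →ₐ[k] FermatTensor q q'} {δ : ι →+ ℕ × ℕ} {P : ℕ → Fin n → k}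

/-- The point of the curve attached to a point of the cone over the Fermat cubic. -/
def cubicPoint (h : IsPointSeqParametrized 𝒞 f δ) (hP : IsPointSeq q P)
    (hq' : IsQuantumParameter q') (hCY' : IsCalabiYauParameter q') (r : fermatCubicCone k) :
    PointModuli 𝒞 :=
  h.point hP (isPointSeq_twistedSeq_of_mem_fermatCubicCone hq' hCY' r.2)

variable (h : IsPointSeqParametrized 𝒞 f δ) (hP : IsPointSeq q P) (hq' : IsQuantumParameter q')
  (hCY' : IsCalabiYauParameter q')

theorem cubicPoint_eq_iff (r s : fermatCubicCone k) :
    h.cubicPoint hP hq' hCY' r = h.cubicPoint hP hq' hCY' s ↔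
      ∃ c : k, c ≠ 0 ∧ (s : Fin 3 → k) = c • r := by
  refine (h.point_eq_point_iff _ _ _ _).trans ?_
  simp only [twistedSeq_zero]
  exact and_iff_right ⟨1, one_ne_zero, (one_smul _ _).symm⟩

theorem curve_eq_range_cubicPoint : h.curve hP = Set.range (h.cubicPoint hP hq' hCY') := by
  refine Set.Subset.antisymm ?_ (Set.range_subset_iff.2 fun r => ⟨_, _, rfl⟩)
  rintro _ ⟨R, hR, rfl⟩
  refine ⟨⟨R 0, hR.mem_fermatCubicCone hq'⟩, (h.point_eq_point_iff _ _ _ _).2 ⟨?_, ?_⟩⟩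
  · exact ⟨1, one_ne_zero, (one_smul _ _).symm⟩
  · exact ⟨1, one_ne_zero, by simp⟩

theorem exists_cubicPoint_mem_basicOpen_iff {p : MvPolynomial (Σ d, 𝒞 d) k}
    (hp : IsMultihomogeneous p) : ∃ G : MvPolynomial (Fin 3) k, ∀ r : fermatCubicCone k,
      h.cubicPoint hP hq' hCY' r ∈ PointModuli.basicOpen 𝒞 p ↔ eval (r : Fin 3 → k) G ≠ 0 := by
  choose g hg using fun s : (Σ d, 𝒞 d) => exists_tensorForm_eq_eval hP (q' 0)
    (fun r : fermatCubicCone k => isPointSeq_twistedSeq_of_mem_fermatCubicCone hq' hCY' r.2)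
    (h.apply_mem s.2.2)
  refine ⟨bind₁ g p, fun r => ?_⟩
  have hr : tensorCoord 𝒞 f δ hP (isPointSeq_twistedSeq_of_mem_fermatCubicCone hq' hCY' r.2) =
      fun s => eval (r : Fin 3 → k) (g s) := funext fun s => hg s r
  rw [cubicPoint, h.point_mem_basicOpen_iff _ _ hp, hr, ← coe_aeval_eq_eval, ← coe_aeval_eq_eval,
    RingHom.coe_coe, RingHom.coe_coe, aeval_bind₁]

variable [IsAlgClosed k]

include hq' hCY'

theorem infinite_curve : (h.curve hP).Infinite := by
  rw [h.curve_eq_range_cubicPoint hP hq' hCY']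
  have : Infinite (fermatCubicChart k 0) := (infinite_fermatCubicChart 0).to_subtype
  refine (Set.infinite_range_of_injective (f := fun r : fermatCubicChart k 0 =>
    h.cubicPoint hP hq' hCY' ⟨r, fermatCubicChart_subset_fermatCubicCone 0 r.2⟩) ?_).mono
      (Set.range_comp_subset_range _ (h.cubicPoint hP hq' hCY'))
  intro r s hrs
  obtain ⟨c, -, hc⟩ := (h.cubicPoint_eq_iff hP hq' hCY' _ _).1 hrs
  have hc₁ : 1 = c := by simpa [r.2.1, s.2.1] using congrFun hc 0
  exact Subtype.ext (by simpa [← hc₁] using hc.symm)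

theorem finite_curve_sdiff_basicOpen_or_disjoint {p : MvPolynomial (Σ d, 𝒞 d) k}
    (hp : IsMultihomogeneous p) :
    (h.curve hP \ PointModuli.basicOpen 𝒞 p).Finite ∨
      Disjoint (h.curve hP) (PointModuli.basicOpen 𝒞 p) := by
  obtain ⟨G, hG⟩ := h.exists_cubicPoint_mem_basicOpen_iff hP hq' hCY' hp
  rw [h.curve_eq_range_cubicPoint hP hq' hCY']
  have hGsmul (r : Fin 3 → k) (hr : r ∈ fermatCubicCone k) (c : k) (hc : c ≠ 0)
      (hr₀ : eval r G = 0) : eval (c • r) G = 0 := by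
    have hcr : h.cubicPoint hP hq' hCY' ⟨r, hr⟩ =
        h.cubicPoint hP hq' hCY' ⟨c • r, smul_mem_fermatCubicCone hr hc⟩ :=
      (h.cubicPoint_eq_iff hP hq' hCY' _ _).2 ⟨c, hc, rfl⟩
    by_contra hcon
    exact (hG ⟨r, hr⟩).1 (hcr ▸ (hG ⟨_, smul_mem_fermatCubicCone hr hc⟩).2 hcon) hr₀
  rcases finite_zeros_or_eq_zero_on_fermatCubicCone hGsmul with ⟨S, hS, hzeros⟩ | hzero
  · left
    refine ((hS.preimage Subtype.val_injective.injOn).image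
      (h.cubicPoint hP hq' hCY')).subset ?_
    rintro _ ⟨⟨r, rfl⟩, hr⟩
    obtain ⟨c, hc, hcr⟩ := hzeros r r.2 (not_not.1 (mt (hG r).2 hr))
    exact ⟨⟨c • r, smul_mem_fermatCubicCone r.2 hc⟩, hcr,
      ((h.cubicPoint_eq_iff hP hq' hCY' _ _).2 ⟨c, hc, rfl⟩).symm⟩
  · right
    rw [Set.disjoint_left]
    rintro _ ⟨r, rfl⟩ hr
    exact (hG r).1 hr (hzero r r.2)

theorem isTopologicalCurve_curve : IsTopologicalCurve (h.curve hP) where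
  isClosed := h.isClosed_curve hP
  infinite := h.infinite_curve hP hq' hCY'
  finite_inter_or_subset _ hZ := finite_inter_or_subset_of_isClosed_generateFrom
    (by
      rintro _ ⟨p, hp, rfl⟩
      exact h.finite_curve_sdiff_basicOpen_or_disjoint hP hq' hCY' hp) hZ

end IsPointSeqParametrized

theorem IsPointSeqParametrized.topologicalKrullDim_eq_one [IsAlgClosed k]
    {q : Fin 4 → Fin 4 → k} {q' : Fin 3 → Fin 3 → k} {𝒞 : ι → Submodule k C}
    {f : C →ₐ[k] FermatTensor q q'} {δ : ι →+ ℕ × ℕ} (h : IsPointSeqParametrized 𝒞 f δ)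
    (hq : IsQuantumParameter q) (hq' : IsQuantumParameter q') (hCY : IsCalabiYauParameter q)
    (hCY' : IsCalabiYauParameter q') (hgen : IsGeneralParameter q) :
    topologicalKrullDim (PointModuli 𝒞) = 1 := by
  obtain ⟨S, hS, hSseq, hSrep⟩ := exists_finite_isPointSeq_representatives hq hCY hgen
  have : Finite S := hS.to_subtype
  have : Nonempty S := by
    obtain ⟨P, hP⟩ := exists_isPointSeq_four hq
    obtain ⟨P', hP', -⟩ := hSrep P hP
    exact ⟨⟨P', hP'⟩⟩
  have : T1Space (PointModuli 𝒞) := PointModuli.t1Space h.iSup_eq_top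
  refine topologicalKrullDim_eq_one_of_isTopologicalCurve_cover
    (W := fun P : S => h.curve (hSseq P P.2))
    (fun P => h.isTopologicalCurve_curve _ hq' hCY') (Set.eq_univ_of_forall fun z => ?_)
  obtain ⟨P, R, hP, hR, rfl⟩ := h.exists_eq_point z
  obtain ⟨P', hP', hc⟩ := hSrep P hP
  exact Set.mem_iUnion.2 ⟨⟨P', hP'⟩, (h.point_mem_curve_iff _ _ _).2 hc⟩

end Dimension

section GeneratorSequence

variable {k C ι : Type*} [Field k] [Ring C] [Algebra k C] [AddMonoid ι] [DecidableEq ι]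
  {𝒞 : ι → Submodule k C}

namespace PointModule

/-- The right action of the algebra on a point module. -/
def toEnd (M : PointModule 𝒞) : C →ₐ[k] (Module.End k M.carrier)ᵐᵒᵖ :=
  AlgHom.opComm.symm (Algebra.lsmul k k M.carrier)

variable (M : PointModule 𝒞) {m : ι → M.carrier} (hm : ∀ d, m d ∈ M.comp d ∧ m d ≠ 0)

include hm

theorem exists_orbitMap_eq_smul (d : ι) {e : ι} {a : C} (ha : a ∈ 𝒞 e) :
    ∃ c : k, orbitMap M.toEnd (m d) a = c • m (d + e) :=
  M.exists_smul_eq (hm _).1 (hm _).2 (M.smul_mem (hm d).1 ha)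

theorem exists_orbitMap_ne_zero_of_le_span (hC : ⨆ d, 𝒞 d = ⊤) {d : ι} {s : Set C}
    (hs : 𝒞 d ≤ Submodule.span k s) : ∃ a ∈ s, orbitMap M.toEnd (m 0) a ≠ 0 := by
  obtain ⟨a, ha, had⟩ := M.exists_op_smul_eq hC (hm 0).1 (hm 0).2 (hm d).1
  by_contra! h
  have hle : Submodule.span k s ≤ LinearMap.ker (orbitMap M.toEnd (m 0)) := Submodule.span_le.2 h
  exact (hm d).2 (had ▸ LinearMap.mem_ker.1 (hle (hs ha)))

theorem exists_orbitMap_prod_map_eq_wordVal_smul (hC : ⨆ d, 𝒞 d = ⊤) {α : Type*} {x : α → C}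
    {D : ι} (hx : ∀ i, x i ∈ 𝒞 D) (hspan : ∀ N : ℕ, 𝒞 (N • D) ≤
      Submodule.span k ((fun l : List α => (l.map x).prod) '' {l | l.length = N})) :
    ∃ c : ℕ → α → k, (∀ d, c d ≠ 0) ∧ ∀ d (l : List α),
      orbitMap M.toEnd (m (d • D)) (l.map x).prod = wordVal c d l • m ((d + l.length) • D) := by
  choose c hc using fun (d : ℕ) i => M.exists_orbitMap_eq_smul hm (d • D) (hx i)
  have hword := orbitMap_prod_map (m := fun d => m (d • D)) fun d i => succ_nsmul D d ▸ hc d i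
  refine ⟨c, fun d => ?_, hword⟩
  obtain ⟨_, ⟨l, hl, rfl⟩, h⟩ := M.exists_orbitMap_ne_zero_of_le_span hm hC (hspan (d + 1))
  have hl₀ := hword 0 l
  simp only [zero_nsmul] at hl₀
  simp only [hl₀] at h
  rw [← zero_add d]
  exact ne_zero_of_wordVal_ne_zero (left_ne_zero_of_smul h) (hl ▸ d.lt_succ_self)

end PointModule

end GeneratorSequence

section WordRelations

universe u

variable {k : Type u} [Field k] {n m : ℕ} {q : Fin n → Fin n → k} {q' : Fin m → Fin m → k}
  {P : ℕ → Fin n → k} {R : ℕ → Fin m → k}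

theorem prod_map_tensorWord {α : Type*} (u : α → List (Fin n)) (u' : α → List (Fin m))
    (l : List α) : (l.map fun i => tensorWord q q' (u i) (u' i)).prod =
      tensorWord q q' (l.flatMap u) (l.flatMap u') := by
  induction l with
  | nil => simp [tensorWord, QuantumPoly.word, ← Algebra.TensorProduct.one_def]
  | cons i l ih => simp [ih, tensorWord_mul]

theorem prod_map_tensorWord_left (l : List (Fin n)) :
    (l.map fun i => tensorWord q q' [i] []).prod = tensorWord q q' l [] := by
  rw [prod_map_tensorWord, List.flatMap_singleton', List.flatMap_eq_nil_iff.2 fun _ _ => rfl]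

theorem prod_map_tensorWord_right (l' : List (Fin m)) :
    (l'.map fun j => tensorWord q q' [] [j]).prod = tensorWord q q' [] l' := by
  rw [prod_map_tensorWord, List.flatMap_singleton', List.flatMap_eq_nil_iff.2 fun _ _ => rfl]

variable {C V : Type*} [Ring C] [Algebra k C] [AddCommGroup V] [Module k V]
  {f : C →ₐ[k] FermatTensor q q'}

theorem isPointSeq_left_of_wordVal (hf : Function.Injective f) (hP : ∀ d, P d ≠ 0)
    (h : ∀ d N, ∃ (w : List (Fin n) → C) (l' : List (Fin m)) (F : C →ₗ[k] V) (v : V), v ≠ 0 ∧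
      ∀ l, l.length = N → f (w l) = tensorWord q q' l l' ∧ F (w l) = wordVal P d l • v) :
    IsPointSeq q P where
  ne_zero := hP
  comm d i j := by
    obtain ⟨w, l', F, v, hv, hw⟩ := h d 2
    have hswap : w [j, i] = q j i • w [i, j] := hf <| by
      rw [map_smul, (hw _ rfl).1, (hw _ rfl).1, tensorWord_pair_swap_left]
    have hF := congrArg F hswap
    rw [map_smul, (hw _ rfl).2, (hw _ rfl).2, smul_smul] at hF
    simpa using smul_left_injective k hv hF
  fermat d := by
    obtain ⟨w, l', F, v, hv, hw⟩ := h d n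
    have hsum : ∑ i, w (List.replicate n i) = 0 := hf <| by
      simp only [map_sum, (hw _ List.length_replicate).1, sum_tensorWord_replicate_left, map_zero]
    have hF := congrArg F hsum
    simp only [map_sum, (hw _ List.length_replicate).2, wordVal_replicate, ← Finset.sum_smul,
      map_zero] at hF
    exact (smul_eq_zero.1 hF).resolve_right hv

theorem isPointSeq_right_of_wordVal (hf : Function.Injective f) (hR : ∀ d, R d ≠ 0)
    (h : ∀ d N, ∃ (w : List (Fin m) → C) (l : List (Fin n)) (F : C →ₗ[k] V) (v : V), v ≠ 0 ∧
      ∀ l', l'.length = N → f (w l') = tensorWord q q' l l' ∧ F (w l') = wordVal R d l' • v) :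
    IsPointSeq q' R where
  ne_zero := hR
  comm d i j := by
    obtain ⟨w, l, F, v, hv, hw⟩ := h d 2
    have hswap : w [j, i] = q' j i • w [i, j] := hf <| by
      rw [map_smul, (hw _ rfl).1, (hw _ rfl).1, tensorWord_pair_swap_right]
    have hF := congrArg F hswap
    rw [map_smul, (hw _ rfl).2, (hw _ rfl).2, smul_smul] at hF
    simpa using smul_left_injective k hv hF
  fermat d := by
    obtain ⟨w, l, F, v, hv, hw⟩ := h d m
    have hsum : ∑ i, w (List.replicate m i) = 0 := hf <| by
      simp only [map_sum, (hw _ List.length_replicate).1, sum_tensorWord_replicate_right, map_zero]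
    have hF := congrArg F hsum
    simp only [map_sum, (hw _ List.length_replicate).2, wordVal_replicate, ← Finset.sum_smul,
      map_zero] at hF
    exact (smul_eq_zero.1 hF).resolve_right hv

end WordRelations

section TensorCase

universe u

variable {k : Type u} [Field k] {n m : ℕ} {q : Fin n → Fin n → k} {q' : Fin m → Fin m → k}
  {P : ℕ → Fin n → k} {R : ℕ → Fin m → k}

theorem exists_eq_mul_mul_of_mul_eq_mul {α β k : Type*} [Field k] {u H : α → k} {v G : β → k}
    (h : ∀ i j, u i * G j = v j * H i) (h₀ : ∃ i j, u i * G j ≠ 0) :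
    ∃ c : k, c ≠ 0 ∧ ∀ i j, u i * G j = c * (u i * v j) := by
  obtain ⟨i₀, j₀, h₀⟩ := h₀
  have hu := left_ne_zero_of_mul h₀
  have hH : H i₀ ≠ 0 := right_ne_zero_of_mul (h i₀ j₀ ▸ h₀)
  refine ⟨H i₀ / u i₀, div_ne_zero hH hu, fun i j => ?_⟩
  field_simp
  linear_combination u i * h i₀ j

namespace PointModule

variable (M : PointModule (fermatTensorDeg q q')) {v : ℕ × ℕ → M.carrier}
  (hv : ∀ d, v d ∈ M.comp d ∧ v d ≠ 0)

include hv

theorem exists_isPointSeq_left : ∃ P : ℕ → Fin n → k, IsPointSeq q P ∧ ∀ d l,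
    orbitMap M.toEnd (v (d, 0)) (tensorWord q q' l []) = wordVal P d l • v (d + l.length, 0) := by
  have hspan (N : ℕ) : fermatTensorDeg q q' (N • (1, 0)) ≤ Submodule.span k
      ((fun l : List (Fin n) => (l.map fun i => tensorWord q q' [i] []).prod) ''
        {l : List (Fin n) | l.length = N}) :=
    fermatTensorDeg_le fun l l' hl hl' => by
      obtain rfl : l' = [] := List.length_eq_zero_iff.1 (by simpa using hl')
      exact Submodule.subset_span ⟨l, by simpa using hl, prod_map_tensorWord_left l⟩
  obtain ⟨P, hP₀, hP⟩ := M.exists_orbitMap_prod_map_eq_wordVal_smul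
    (x := fun i => tensorWord q q' [i] []) (D := (1, 0)) hv (iSup_fermatTensorDeg q q')
    (fun i => tensorWord_mem_fermatTensorDeg q q' [i] []) hspan
  simp only [prod_map_tensorWord_left, Prod.smul_mk, smul_eq_mul, mul_one, mul_zero] at hP
  exact ⟨P, isPointSeq_left_of_wordVal (f := AlgHom.id k _) Function.injective_id hP₀ fun d N =>
    ⟨_, [], orbitMap M.toEnd (v (d, 0)), v (d + N, 0), (hv _).2,
      fun l hl => ⟨rfl, hl ▸ hP d l⟩⟩, hP⟩

theorem exists_isPointSeq_right : ∃ R : ℕ → Fin m → k, IsPointSeq q' R ∧ ∀ d l',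
    orbitMap M.toEnd (v (0, d)) (tensorWord q q' [] l') =
      wordVal R d l' • v (0, d + l'.length) := by
  have hspan (N : ℕ) : fermatTensorDeg q q' (N • (0, 1)) ≤ Submodule.span k
      ((fun l' : List (Fin m) => (l'.map fun j => tensorWord q q' [] [j]).prod) ''
        {l' : List (Fin m) | l'.length = N}) :=
    fermatTensorDeg_le fun l l' hl hl' => by
      obtain rfl : l = [] := List.length_eq_zero_iff.1 (by simpa using hl)
      exact Submodule.subset_span ⟨l', by simpa using hl', prod_map_tensorWord_right l'⟩
  obtain ⟨R, hR₀, hR⟩ := M.exists_orbitMap_prod_map_eq_wordVal_smul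
    (x := fun j => tensorWord q q' [] [j]) (D := (0, 1)) hv (iSup_fermatTensorDeg q q')
    (fun j => tensorWord_mem_fermatTensorDeg q q' [] [j]) hspan
  simp only [prod_map_tensorWord_right, Prod.smul_mk, smul_eq_mul, mul_one, mul_zero] at hR
  exact ⟨R, isPointSeq_right_of_wordVal (f := AlgHom.id k _) Function.injective_id hR₀ fun d N =>
    ⟨_, [], orbitMap M.toEnd (v (0, d)), v (0, d + N), (hv _).2,
      fun l hl => ⟨rfl, hl ▸ hR d l⟩⟩, hR⟩

theorem exists_orbitMap_tensorWord_eq_smul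
    (hP : ∀ d l, orbitMap M.toEnd (v (d, 0)) (tensorWord q q' l []) =
      wordVal P d l • v (d + l.length, 0))
    (hR : ∀ d l', orbitMap M.toEnd (v (0, d)) (tensorWord q q' [] l') =
      wordVal R d l' • v (0, d + l'.length)) (d : ℕ × ℕ) :
    ∃ c : k, c ≠ 0 ∧ ∀ l l', l.length = d.1 → l'.length = d.2 →
      orbitMap M.toEnd (v 0) (tensorWord q q' l l') =
        (c * (wordVal P 0 l * wordVal R 0 l')) • v d := by
  choose G hG using fun l' : List.Vector (Fin m) d.2 =>
    M.exists_orbitMap_eq_smul hv (d.1, 0) (tensorWord_mem_fermatTensorDeg q q' [] l'.1)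
  choose H hH using fun l : List.Vector (Fin n) d.1 =>
    M.exists_orbitMap_eq_smul hv (0, d.2) (tensorWord_mem_fermatTensorDeg q q' l.1 [])
  have hPG (l : List.Vector (Fin n) d.1) (l' : List.Vector (Fin m) d.2) :
      orbitMap M.toEnd (v 0) (tensorWord q q' l.1 l'.1) = (wordVal P 0 l.1 * G l') • v d := by
    have hmul := tensorWord_mul (q := q) (q' := q') l.1 [] [] l'.1
    have hl : orbitMap M.toEnd (v 0) (tensorWord q q' l.1 []) = wordVal P 0 l.1 • v (d.1, 0) := by
      simpa [l.2, ← Prod.zero_eq_mk] using hP 0 l.1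
    rw [List.append_nil, List.nil_append] at hmul
    rw [← hmul, orbitMap_mul, hl, orbitMap_smul, hG, smul_smul]
    simp [l'.2]
  have hRH (l : List.Vector (Fin n) d.1) (l' : List.Vector (Fin m) d.2) :
      orbitMap M.toEnd (v 0) (tensorWord q q' l.1 l'.1) = (wordVal R 0 l'.1 * H l) • v d := by
    have hmul := tensorWord_mul (q := q) (q' := q') [] l.1 l'.1 []
    have hl' : orbitMap M.toEnd (v 0) (tensorWord q q' [] l'.1) =
        wordVal R 0 l'.1 • v (0, d.2) := by
      simpa [l'.2, ← Prod.zero_eq_mk] using hR 0 l'.1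
    rw [List.append_nil, List.nil_append] at hmul
    rw [← hmul, orbitMap_mul, hl', orbitMap_smul, hH, smul_smul]
    simp [l.2]
  obtain ⟨_, ⟨l, hl, l', hl', rfl⟩, h₀⟩ := M.exists_orbitMap_ne_zero_of_le_span hv
    (iSup_fermatTensorDeg q q') (fermatTensorDeg_eq_span q q' d).le
  obtain ⟨c, hc, h⟩ := exists_eq_mul_mul_of_mul_eq_mul
    (fun l l' => smul_left_injective k (hv d).2 ((hPG l l').symm.trans (hRH l l')))
    ⟨⟨l, hl⟩, ⟨l', hl'⟩, left_ne_zero_of_smul (hPG ⟨l, hl⟩ ⟨l', hl'⟩ ▸ h₀)⟩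
  exact ⟨c, hc, fun l l' hl hl' => h ⟨l, hl⟩ ⟨l', hl'⟩ ▸ hPG ⟨l, hl⟩ ⟨l', hl'⟩⟩

end PointModule

variable (q q') in
theorem isPointSeqParametrized_fermatTensorDeg : IsPointSeqParametrized (fermatTensorDeg q q')
    (AlgHom.id k _) (AddMonoidHom.id _) where
  iSup_eq_top := iSup_fermatTensorDeg q q'
  map_eq _ := Submodule.map_id _
  injective := Function.injective_id
  exists_eq_one := ⟨(1, 1), rfl⟩
  exists_coord := by
    rintro M φ ⟨v, hv, hφ⟩
    obtain ⟨P, hP, hPv⟩ := M.exists_isPointSeq_left hv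
    obtain ⟨R, hR, hRv⟩ := M.exists_isPointSeq_right hv
    choose c hc hcv using M.exists_orbitMap_tensorWord_eq_smul hv hPv hRv
    refine ⟨P, R, hP, hR, c, hc, fun ⟨d, a⟩ => smul_left_injective k (hv d).2 ?_⟩
    refine (hφ d a).symm.trans <| fermatTensorDeg_le (S := LinearMap.eqLocus
      (orbitMap M.toEnd (v 0)) ((c d • tensorForm hP hR d).smulRight (v d)))
      (fun l l' hl hl' => ?_) a.2
    rw [LinearMap.mem_eqLocus, hcv d l l' hl hl', LinearMap.smulRight_apply, LinearMap.smul_apply,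
      tensorForm_word hP hR hl hl', smul_eq_mul]

end TensorCase

section DiagonalCase

universe u

variable {k : Type u} [Field k] {n m : ℕ} {q : Fin n → Fin n → k} {q' : Fin m → Fin m → k}
  {C : Type u} [Ring C] [Algebra k C] {f : C →ₐ[k] FermatTensor q q'} {x : Fin n × Fin m → C}

theorem map_prod_map_eq_tensorWord (hx : ∀ i, f (x i) = tensorWord q q' [i.1] [i.2])
    (l : List (Fin n × Fin m)) :
    f (l.map x).prod = tensorWord q q' (l.map Prod.fst) (l.map Prod.snd) := by
  have hx' : f ∘ x = fun i => tensorWord q q' [i.1] [i.2] := funext hx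
  rw [map_list_prod, List.map_map, hx', prod_map_tensorWord, ← List.map_eq_flatMap,
    ← List.map_eq_flatMap]

theorem map_prod_map_zip (hx : ∀ i, f (x i) = tensorWord q q' [i.1] [i.2]) {l : List (Fin n)}
    {l' : List (Fin m)} (h : l.length = l'.length) :
    f ((l.zip l').map x).prod = tensorWord q q' l l' := by
  rw [map_prod_map_eq_tensorWord hx, List.map_fst_zip h.le, List.map_snd_zip h.ge]

theorem le_span_prod_map {𝒞 : ℕ → Submodule k C} (hf : Function.Injective f)
    (hmap : ∀ d, (𝒞 d).map f.toLinearMap = fermatTensorDeg q q' (d, d))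
    (hx : ∀ i, f (x i) = tensorWord q q' [i.1] [i.2]) (d : ℕ) :
    𝒞 d ≤ Submodule.span k
      ((fun l : List (Fin n × Fin m) => (l.map x).prod) '' {l | l.length = d}) := by
  refine (Submodule.map_le_map_iff_of_injective (f := f.toLinearMap) hf _ _).1 ?_
  rw [hmap]
  refine fermatTensorDeg_le fun l l' hl hl' => ?_
  rw [← map_prod_map_zip hx (hl.trans hl'.symm)]
  exact Submodule.mem_map_of_mem (Submodule.subset_span ⟨l.zip l', by simp [hl, hl'], rfl⟩)

theorem exists_eq_mul_of_swap {c c' : Fin n × Fin m → k} (hc' : c' ≠ 0)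
    (h : ∀ i j a b, c (j, a) * c' (i, b) = q j i * (c (i, a) * c' (j, b))) :
    ∃ (P : Fin n → k) (R : Fin m → k), c = fun i => P i.1 * R i.2 := by
  obtain ⟨⟨s, t⟩, hst⟩ := Function.ne_iff.1 hc'
  refine ⟨fun i => q i s * c' (i, t) / c' (s, t), fun j => c (s, j), funext fun ⟨i, j⟩ => ?_⟩
  rw [div_mul_eq_mul_div, eq_div_iff hst, h s i j t]
  ring

theorem exists_isPointSeq_mul_eq {V : Type*} [AddCommGroup V] [Module k V]
    (hf : Function.Injective f) (hx : ∀ i, f (x i) = tensorWord q q' [i.1] [i.2])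
    {F : ℕ → C →ₗ[k] V} {v : ℕ → V} (hv : ∀ d, v d ≠ 0) {c : ℕ → Fin n × Fin m → k}
    (hc : ∀ d, c d ≠ 0) (hF : ∀ d l, F d (l.map x).prod = wordVal c d l • v (d + l.length)) :
    ∃ (P : ℕ → Fin n → k) (R : ℕ → Fin m → k), IsPointSeq q P ∧ IsPointSeq q' R ∧
      c = fun d i => P d i.1 * R d i.2 := by
  have hswap (d : ℕ) (i j : Fin n) (a b : Fin m) :
      c d (j, a) * c (d + 1) (i, b) = q j i * (c d (i, a) * c (d + 1) (j, b)) := by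
    have h : ([(j, a), (i, b)].map x).prod = q j i • ([(i, a), (j, b)].map x).prod := hf <| by
      rw [map_smul, map_prod_map_eq_tensorWord hx, map_prod_map_eq_tensorWord hx]
      exact tensorWord_pair_swap_left i j [a, b]
    have hFd := congrArg (F d) h
    rw [map_smul, hF, hF, smul_smul] at hFd
    simpa using smul_left_injective k (hv (d + 2)) hFd
  choose P R hPR using fun d => exists_eq_mul_of_swap (hc (d + 1)) (hswap d)
  obtain rfl : c = fun d i => P d i.1 * R d i.2 := funext hPR
  have hP (d : ℕ) : P d ≠ 0 := fun h => hc d (funext fun i => by simp [h])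
  have hR (d : ℕ) : R d ≠ 0 := fun h => hc d (funext fun i => by simp [h])
  have hzip (d N : ℕ) (l : List (Fin n)) (l' : List (Fin m)) (hl : l.length = N)
      (hl' : l'.length = N) : F d ((l.zip l').map x).prod =
        (wordVal P d l * wordVal R d l') • v (d + N) := by
    rw [hF, wordVal_prod, List.map_fst_zip (by lia), List.map_snd_zip (by lia), List.length_zip,
      hl, hl', min_self]
  refine ⟨P, R, isPointSeq_left_of_wordVal (V := V) hf hP fun d N => ?_,
    isPointSeq_right_of_wordVal (V := V) hf hR fun d N => ?_, rfl⟩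
  · obtain ⟨l', hl', h₀⟩ := exists_wordVal_ne_zero hR d N
    refine ⟨fun l => ((l.zip l').map x).prod, l', F d, wordVal R d l' • v (d + N),
      smul_ne_zero h₀ (hv _), fun l hl => ⟨map_prod_map_zip hx (hl.trans hl'.symm), ?_⟩⟩
    rw [hzip d N l l' hl hl', smul_smul]
  · obtain ⟨l, hl, h₀⟩ := exists_wordVal_ne_zero hP d N
    refine ⟨fun l' => ((l.zip l').map x).prod, l, F d, wordVal P d l • v (d + N),
      smul_ne_zero h₀ (hv _), fun l' hl' => ⟨map_prod_map_zip hx (hl.trans hl'.symm), ?_⟩⟩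
    rw [hzip d N l l' hl hl', smul_smul, mul_comm]

theorem isPointSeqParametrized_diag {𝒞 : ℕ → Submodule k C} (hC : ⨆ d, 𝒞 d = ⊤)
    (hf : Function.Injective f)
    (hmap : ∀ d, (𝒞 d).map f.toLinearMap = fermatTensorDeg q q' (d, d)) :
    IsPointSeqParametrized 𝒞 f ((AddMonoidHom.id ℕ).prod (AddMonoidHom.id ℕ)) where
  iSup_eq_top := hC
  map_eq := hmap
  injective _ _ h := congrArg Prod.fst h
  exists_eq_one := ⟨1, rfl⟩
  exists_coord := by
    rintro M φ ⟨v, hv, hφ⟩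
    choose x hx₁ hx using fun i : Fin n × Fin m =>
      (hmap 1).ge (tensorWord_mem_fermatTensorDeg q q' [i.1] [i.2])
    have hspan := le_span_prod_map hf hmap hx
    obtain ⟨c, hc, hcv⟩ := M.exists_orbitMap_prod_map_eq_wordVal_smul (D := 1) hv hC hx₁
      fun N => by simpa only [smul_eq_mul, mul_one] using hspan N
    simp only [smul_eq_mul, mul_one] at hcv
    obtain ⟨P, R, hP, hR, rfl⟩ := exists_isPointSeq_mul_eq hf hx (fun d => (hv d).2) hc hcv
    refine ⟨P, R, hP, hR, fun _ => 1, fun _ => one_ne_zero, fun ⟨d, a⟩ => ?_⟩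
    refine smul_left_injective k (hv d).2 ((hφ d a).symm.trans ?_)
    have hle : 𝒞 d ≤ LinearMap.eqLocus (orbitMap M.toEnd (v 0))
        ((tensorForm hP hR (d, d) ∘ₗ f.toLinearMap).smulRight (v d)) := by
      refine (hspan d).trans (Submodule.span_le.2 ?_)
      rintro _ ⟨l, hl, rfl⟩
      have hl : l.length = d := hl
      rw [SetLike.mem_coe, LinearMap.mem_eqLocus, LinearMap.smulRight_apply, LinearMap.comp_apply,
        AlgHom.toLinearMap_apply, map_prod_map_eq_tensorWord hx,
        tensorForm_word hP hR (by simpa using hl) (by simpa using hl), hcv, wordVal_prod, zero_add,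
        hl]
    rw [one_mul]
    exact hle a.2

end DiagonalCase

section SegreQuotient

universe u

open scoped TensorProduct

variable {k A B : Type u} [Field k] [Ring A] [Algebra k A] [Ring B] [Algebra k B]
  (𝒜 : ℕ → Submodule k A) (ℬ : ℕ → Submodule k B) [SetLike.GradedMonoid 𝒜]
  [SetLike.GradedMonoid ℬ] (J : TwoSidedIdeal (A ⊗[k] B))

theorem iSup_comap_segreProduct :
    ⨆ d : ℕ, (tensorDeg 𝒜 ℬ (d, d)).comap (segreProduct 𝒜 ℬ).val.toLinearMap = ⊤ := by
  rw [eq_top_iff]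
  rintro ⟨z, hz⟩ -
  induction hz using Submodule.iSup_induction' with
  | zero => exact zero_mem _
  | add a b _ _ ha hb => exact add_mem ha hb
  | mem d a ha => exact Submodule.mem_iSup_of_mem d ha

theorem iSup_segreQuotDeg : ⨆ d, segreQuotDeg 𝒜 ℬ J d = ⊤ := by
  simp only [segreQuotDeg]
  rw [← Submodule.map_iSup, iSup_comap_segreProduct, Submodule.map_top, LinearMap.range_eq_top]
  exact RingCon.mkₐ_surjective (α := k) _

/-- The homomorphism `A ∘ B / J_Δ → A ⊗ B / J` induced by the inclusion of `A ∘ B`. -/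
def segreToTensor : (diagIdeal 𝒜 ℬ J).ringCon.Quotient →ₐ[k] J.ringCon.Quotient :=
  RingCon.liftₐ _ ((J.ringCon.mkₐ k).comp (segreProduct 𝒜 ℬ).val) fun _ _ h => (RingCon.eq _).2 h

theorem segreToTensor_injective : Function.Injective (segreToTensor 𝒜 ℬ J) := by
  intro a b
  obtain ⟨a, rfl⟩ := RingCon.mkₐ_surjective (α := k) _ a
  obtain ⟨b, rfl⟩ := RingCon.mkₐ_surjective (α := k) _ b
  exact fun h => (RingCon.eq _).2 ((RingCon.eq J.ringCon).1 h)

theorem map_segreToTensor_segreQuotDeg (d : ℕ) :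
    (segreQuotDeg 𝒜 ℬ J d).map (segreToTensor 𝒜 ℬ J).toLinearMap =
      tensorQuotDeg 𝒜 ℬ J (d, d) := by
  have hle : tensorDeg 𝒜 ℬ (d, d) ≤ LinearMap.range (segreProduct 𝒜 ℬ).val.toLinearMap :=
    fun z hz => ⟨⟨z, Submodule.mem_iSup_of_mem d hz⟩, rfl⟩
  rw [tensorQuotDeg, ← Submodule.map_comap_eq_of_le hle, segreQuotDeg, ← Submodule.map_comp,
    ← Submodule.map_comp]
  rfl

end SegreQuotient

theorem isPointSeqParametrized_segreQuotDeg {k : Type*} [Field k] {n m : ℕ} (q : Fin n → Fin n → k)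
    (q' : Fin m → Fin m → k) :
    IsPointSeqParametrized
      (segreQuotDeg (QuantumPoly.deg q) (QuantumPoly.deg q') (idealJ q q'))
      (segreToTensor (QuantumPoly.deg q) (QuantumPoly.deg q') (idealJ q q'))
      ((AddMonoidHom.id ℕ).prod (AddMonoidHom.id ℕ)) :=
  isPointSeqParametrized_diag (iSup_segreQuotDeg _ _ _) (segreToTensor_injective _ _ _)
    (map_segreToTensor_segreQuotDeg _ _ _)

end

theorem proposition4p2_general {k : Type*} [Field k] [IsAlgClosed k]
    (q : Fin 4 → Fin 4 → k) (q' : Fin 3 → Fin 3 → k)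
    (hq : IsQuantumParameter q) (hq' : IsQuantumParameter q')
    (hCY : IsCalabiYauParameter q) (hCY' : IsCalabiYauParameter q')
    (hgen : IsGeneralParameter q) :
    topologicalKrullDim (TensorPointModuli q q') = 1 ∧
      topologicalKrullDim (SegrePointModuli q q') = 1 :=
  ⟨(isPointSeqParametrized_fermatTensorDeg q q').topologicalKrullDim_eq_one hq hq' hCY hCY' hgen,
    (isPointSeqParametrized_segreQuotDeg q q').topologicalKrullDim_eq_one hq hq' hCY hCY' hgen⟩

theorem proposition4p2 {k : Type*} [Field k] [IsAlgClosed k] [CharZero k]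
    (q : Fin 4 → Fin 4 → k) (q' : Fin 3 → Fin 3 → k)
    (hq : IsQuantumParameter q) (hq' : IsQuantumParameter q')
    (hCY : IsCalabiYauParameter q) (hCY' : IsCalabiYauParameter q')
    (hgen : IsGeneralParameter q) :
    topologicalKrullDim (TensorPointModuli q q') = 1 ∧
      topologicalKrullDim (SegrePointModuli q q') = 1 :=
  proposition4p2_general q q' hq hq' hCY hCY' hgen
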